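/- Let $m,n\ge 1$, let $D\subset\mathbb R^m$ be open, $\epsilon_0>0$, and let $F_\epsilon:D\to\mathbb R^m$, $|\epsilon|<\epsilon_0$, be a near-identity family of class $\mathcal C^{2n+1}$, i.e. $(\epsilon,x)\mapsto F_\epsilon(x)$ is $\mathcal C^{2n+1}$ on $(-\epsilon_0,\epsilon_0)\times D$ and $F_0(x)=x$. For $x\in D$ let $x_k=F_\epsilon^k(x)$, where for $k<0$ the iterates are those of the near-identity branch of $F_\epsilon^{-1}$, which sends $y$ to its nearest preimage in $D$. We say that the iterates $x_k$, $|k|\le n$, are defined if they all lie in $D$ and $F_\epsilon(x_k)=x_{k+1}$ for $-n\le k<n$. In this case, for $\epsilon\neq0$, let $p_n(t,x,\epsilon)$ be the unique $\mathbb R^m$-valued polynomial in $t$ of degree at most $2n$ with $p_n(\epsilon k,x,\epsilon)=x_k$ for all integers $|k|\le n$. The interpolating vector field is $X_n(x,\epsilon)=\partial_tp_n(0,x,\epsilon)$, and $X_n(x,0)=\lim_{\epsilon\to0}X_n(x,\epsilon)$. Let $D_0\subset D$ be compact. Then there are $\epsilon_1\in(0,\epsilon_0]$ and constants $M,C$ such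 that: (a) for all $x\in D_0$ and $|\epsilon|<\epsilon_1$ the iterates $x_k$, $|k|\le n$, are defined, and the limit defining $X_n(x,0)$ exists; (b) $|X_n(x,\epsilon)|\le M$ for all $x\in D_0$ and $|\epsilon|<\epsilon_1$; (c) for all $x\in D_0$ and $|\epsilon|<\epsilon_1$ the time-$\epsilon$ map $\Phi^\epsilon_{X_n}(x)$ is well defined: there is a solution $\gamma$ of $\dot\gamma=X_n(\gamma,\epsilon)$, $\gamma(0)=x$, on the closed interval between $0$ and $\epsilon$, staying in the set of points where the iterates $x_k$, $|k|\le n$, are defined, and all such solutions have the same end point $\gamma(\epsilon)=:\Phi^\epsilon_{X_n}(x)$; (d) $|F_\epsilon(x)-\Phi^\epsilon_{X_n}(x)|\le C|\epsilon|^{2n+1}$ for all $x\in D_0$ and $|\epsilon|<\epsilon_1$. -/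

import Mathlib

open Set Filter Topology

noncomputable section

namespace InterpVF

/-- The phase space `ℝ^m` with its Euclidean norm. -/
abbrev Space (m : ℕ) : Type := EuclideanSpace ℝ (Fin m)

open Classical in
/-- The near-identity branch of the inverse of `f : D → ℝ^m`: a preimage of `y` in `D` that lies
nearest to `y`. If `f` is injective on `D`, this is the inverse of `f` on `f '' D`. In general
`f` has an inverse only locally, near the identity, and this is the branch given
by the inverse function theorem. The value `y` is used where there is no nearest preimage. -/
def localInverse {m : ℕ} (D : Set (Space m)) (f : Space m → Space m) (y : Space m) : Space m :=
  if h : ∃ x ∈ D, f x = y ∧ ∀ x' ∈ D, f x' = y → dist x y ≤ dist x' y then h.choose else y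

/-- The iterates `x_k = f^k(x)` for `k : ℤ`. -/
def iter {m : ℕ} (D : Set (Space m)) (f : Space m → Space m) : ℤ → Space m → Space m
  | Int.ofNat k => f^[k]
  | Int.negSucc k => (localInverse D f)^[k + 1]

/-- The points `x` whose iterates `x_k`, `|k| ≤ n`, are defined: all of them lie in `D`, and
`f` maps each of them to the next one (for `k < 0` this says that the inverse branch exists
at the points where it is used). -/
def iterDomain {m : ℕ} (D : Set (Space m)) (f : Space m → Space m) (n : ℕ) : Set (Space m) :=
  {x | (∀ k ∈ Set.Icc (-(n : ℤ)) n, iter D f k x ∈ D) ∧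
    ∀ k ∈ Set.Ico (-(n : ℤ)) n, f (iter D f k x) = iter D f (k + 1) x}

/-- The interpolating curve `t ↦ p_n(t, x, ε)` of degree at most `2 n` with
`p_n(ε k, x, ε) = x_k` for `|k| ≤ n` (for `ε ≠ 0`), where `x_k = F_ε^k(x)`. -/
def interpCurve {m : ℕ} (D : Set (Space m)) (F : ℝ → Space m → Space m) (n : ℕ) (x : Space m)
    (ε t : ℝ) : Space m :=
  ∑ k ∈ Finset.Icc (-(n : ℤ)) n,
    (Lagrange.basis (Finset.Icc (-(n : ℤ)) n) (fun j : ℤ => ε * (j : ℝ)) k).eval t •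
      iter D (F ε) k x

open Classical in
/-- The interpolating vector field `X_n(x, ε) = ∂_t p_n(0, x, ε)` for `ε ≠ 0`, extended to `ε = 0`
by its limit. -/
def interpField {m : ℕ} (D : Set (Space m)) (F : ℝ → Space m → Space m) (n : ℕ) (ε : ℝ)
    (x : Space m) : Space m :=
  if ε = 0 then limUnder (𝓝[≠] (0 : ℝ)) (fun δ => deriv (interpCurve D F n x δ) 0)
  else deriv (interpCurve D F n x ε) 0

/-- `y` is reached from `x` in time `T` (of either sign) along a solution of `γ' = v(γ)` that
stays in the set `U` on which `v` is considered. -/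
def FlowsTo {m : ℕ} (U : Set (Space m)) (v : Space m → Space m) (T : ℝ) (x y : Space m) : Prop :=
  ∃ γ : ℝ → Space m, γ 0 = x ∧ γ T = y ∧ (∀ t ∈ Set.uIcc 0 T, γ t ∈ U) ∧
    IsIntegralCurveOn γ (fun _ => v) (Set.uIcc 0 T)

open Classical in
/-- The time-`T` map of the vector field `v` on `U` (the value `x` is used where
no solution exists up to time `T`). -/
def timeMap {m : ℕ} (U : Set (Space m)) (v : Space m → Space m) (T : ℝ) (x : Space m) : Space m :=
  if h : ∃ y, FlowsTo U v T x y then h.choose else x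

end InterpVF

end

/-!
Fix `ε`, put `η = |ε|` and `u = F_ε - id`, and rescale time by `ε`, so that the nodes become
the integers `-n, …, n` and `ε X_n(y, ε) = ∑ wₖ F_ε^k(y)` with the weights `wₖ` of the central
difference formula (`stepField`). In these terms the assertion concerns the time-one map, and all
estimates are uniform because `u` and its `x`-derivatives up to order `2 n` are `O(η)` near the
compact set (`eventually_isNearIdentity`): they are jointly `C¹` and vanish at `ε = 0`.

The heart of the matter is that the interpolating curve `q(s) = p_n(ε s)` through an orbit solves
`q' = ε X_n(q)` up to `O(η^(2n+1))`.

* A curve whose `i`-th derivative is `O(ηⁱ)` makes `u ∘ q` a polynomial of degree less than `m` up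
  to `O(η^(m+1))`, by the bound for derivatives of compositions and Taylor's theorem
  (`exists_polyCurve_approx_comp`). Since `Δ^(m+1) x = Δ^m (u ∘ x)` along an orbit, induction gives
  that `m`-th finite differences are `O(η^m)` (`exists_bound_fwdDiff_orbit`), so that the Newton
  form of `q` does have derivatives of the required size.
* Hence `u(q(s)) - (q(s+1) - q(s))` is a polynomial of degree less than `2 n` up to `O(η^(2n+1))`.
  It vanishes at the `2 n` nodes `-n, …, n-1`, and so `F_ε(q(s)) = q(s+1) + O(η^(2n+1))` for
  real `s` (`exists_bound_interp_defect`).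
* By shadowing (`norm_orbit_sub_pseudoOrbit_le`), `F_ε^k(q(s)) = q(s+k) + O(η^(2n+1))` for
  `|k| ≤ n`. The central difference formula is exact on `q`, whence
  `ε X_n(q(s)) = ∑ wₖ q(s+k) + O(η^(2n+1)) = q'(s) + O(η^(2n+1))`.

Since `q(0) = x`, `q(1) = F_ε(x)`, and the field `ε X_n` is Lipschitz with a small constant,
Grönwall's inequality bounds the distance of `F_ε(x)` to the time-one map (`slow_field_dynamics`).
Existence of the solution is the Picard-Lindelöf theorem; uniqueness among all solutions holds
because the field is too slow for a solution to leave the ball on which the estimates hold. Finally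
`ε X_n(x, ε) = u(x) + O(η²)` identifies the limit of `X_n(x, ε)` as the velocity of `F_ε(x)` at `0`.
No smoothness of the inverse branch is needed, only its existence (`localInverse_spec`).
-/

noncomputable section

namespace InterpVF

open Metric

/-! ### Polynomial curves -/

section PolyCurve

variable {E : Type*} [NormedAddCommGroup E] [NormedSpace ℝ E]

/-- The `E`-valued polynomial functions of degree less than `d` of a real variable. -/
def polyCurve (E : Type*) [NormedAddCommGroup E] [NormedSpace ℝ E] (d : ℕ) :
    Submodule ℝ (ℝ → E) :=
  Submodule.span ℝ {f | ∃ P : Polynomial ℝ, P.degree < d ∧ ∃ c : E, f = fun s => P.eval s • c}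

lemma eval_smul_mem_polyCurve {d : ℕ} {P : Polynomial ℝ} (hP : P.degree < d) (c : E) :
    (fun s => P.eval s • c) ∈ polyCurve E d :=
  Submodule.subset_span ⟨P, hP, c, rfl⟩

lemma sum_eval_smul_mem_polyCurve {ι : Type*} {S : Finset ι} {d : ℕ} {P : ι → Polynomial ℝ}
    (hP : ∀ i ∈ S, (P i).degree < d) (c : ι → E) :
    (fun s => ∑ i ∈ S, (P i).eval s • c i) ∈ polyCurve E d := by
  have : (fun s => ∑ i ∈ S, (P i).eval s • c i) = ∑ i ∈ S, fun s => (P i).eval s • c i := by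
    ext s; simp
  rw [this]
  exact Submodule.sum_mem _ fun i hi => eval_smul_mem_polyCurve (hP i hi) _

lemma polyCurve_contDiff {d : ℕ} {f : ℝ → E} (hf : f ∈ polyCurve E d) {N : WithTop ℕ∞} :
    ContDiff ℝ N f := by
  induction hf using Submodule.span_induction with
  | mem f h =>
    obtain ⟨P, -, c, rfl⟩ := h
    have : ContDiff ℝ N fun s => P.eval s := by
      simpa [Polynomial.aeval_def] using! P.contDiff_aeval (𝕜 := ℝ) N
    exact this.smul contDiff_const
  | zero => exact contDiff_const
  | add f g _ _ hf hg => exact hf.add hg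
  | smul a f _ hf => exact contDiff_const.smul hf

/-- A polynomial curve of degree less than the number of nodes is its own Lagrange interpolant. -/
lemma polyCurve_eq_lagrange {ι : Type*} [DecidableEq ι] {S : Finset ι} {v : ι → ℝ}
    (hv : Set.InjOn v S) {f : ℝ → E} (hf : f ∈ polyCurve E S.card) (s : ℝ) :
    f s = ∑ k ∈ S, (Lagrange.basis S v k).eval s • f (v k) := by
  induction hf using Submodule.span_induction with
  | mem f h =>
    obtain ⟨P, hP, c, rfl⟩ := h
    simp only [smul_smul, ← Finset.sum_smul]
    congr 1
    conv_lhs => rw [Lagrange.eq_interpolate hv hP]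
    simp [Lagrange.interpolate_apply, Polynomial.eval_finsetSum, mul_comm]
  | zero => simp
  | add f g _ _ hf hg => simp only [Pi.add_apply, smul_add, Finset.sum_add_distrib, ← hf, ← hg]
  | smul a f _ hf =>
    simp only [Pi.smul_apply, smul_comm _ a, ← Finset.smul_sum, ← hf]

lemma polyCurve_comp_add {d : ℕ} {f : ℝ → E} (hf : f ∈ polyCurve E d) (a : ℝ) :
    (fun s => f (s + a)) ∈ polyCurve E d := by
  induction hf using Submodule.span_induction with
  | mem f h =>
    obtain ⟨P, hP, c, rfl⟩ := h
    have := eval_smul_mem_polyCurve (d := d) (P := Polynomial.taylor a P)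
      (by rwa [Polynomial.degree_taylor]) c
    simpa [Polynomial.taylor_eval, add_comm] using this
  | zero => exact Submodule.zero_mem _
  | add f g _ _ hf hg => exact Submodule.add_mem _ hf hg
  | smul a f _ hf => exact Submodule.smul_mem _ a hf

/-- The difference operator lowers the degree. -/
lemma polyCurve_shift_sub {d : ℕ} {f : ℝ → E} (hf : f ∈ polyCurve E (d + 1)) :
    (fun s => f (s + 1) - f s) ∈ polyCurve E d := by
  induction hf using Submodule.span_induction with
  | mem f h =>
    obtain ⟨P, hP, c, rfl⟩ := h
    have hdeg : (Polynomial.taylor 1 P - P).degree < d := by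
      by_cases h0 : P = 0
      · simp [h0]
      have h1 : (Polynomial.taylor 1 P - P).degree < P.degree := by
        rw [← Polynomial.degree_taylor P 1]
        refine Polynomial.degree_sub_lt_left (Polynomial.degree_taylor P 1) ?_ ?_
        · exact fun h => h0 (Polynomial.taylor_injective 1 (by simpa using h))
        · simp [Polynomial.leadingCoeff_taylor]
      rw [Polynomial.degree_eq_natDegree h0] at h1 hP
      refine h1.trans_le ?_
      have : P.natDegree < d + 1 := by exact_mod_cast hP
      exact_mod_cast Nat.lt_succ_iff.1 this
    have := eval_smul_mem_polyCurve hdeg c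
    simpa [Polynomial.taylor_eval, add_comm, sub_smul] using this
  | zero =>
    convert! Submodule.zero_mem _ using 1
    ext s; simp
  | add f g _ _ hf hg =>
    convert! Submodule.add_mem _ hf hg using 1
    ext s; simp; abel
  | smul a f _ hf =>
    convert! Submodule.smul_mem _ a hf using 1
    ext s; simp [smul_sub]

/-- The `m`-th finite difference annihilates polynomials of degree less than `m`. -/
lemma polyCurve_alternating_sum {m : ℕ} {f : ℝ → E} (hf : f ∈ polyCurve E m) :
    ∑ k ∈ Finset.range (m + 1), ((-1 : ℤ) ^ (m - k) * m.choose k) • f k = 0 := by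
  induction hf using Submodule.span_induction with
  | mem f h =>
    obtain ⟨P, hP, c, rfl⟩ := h
    by_cases h0 : P = 0
    · simp [h0]
    have hn : P.natDegree < m := by
      rw [Polynomial.degree_eq_natDegree h0] at hP; exact_mod_cast hP
    have := congr_fun (Polynomial.fwdDiff_iter_eq_zero_of_degree_lt hn) 0
    rw [fwdDiff_iter_eq_sum_shift] at this
    simp only [← smul_assoc, ← Finset.sum_smul]
    rw [Pi.zero_apply] at this
    convert! zero_smul ℝ c
    simpa using! this
  | zero => simp
  | add f g _ _ hf hg =>
    simp only [Pi.add_apply, smul_add, Finset.sum_add_distrib, hf, hg, add_zero]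
  | smul a f _ hf =>
    simp only [Pi.smul_apply, smul_comm _ a, ← Finset.smul_sum, hf, smul_zero]

end PolyCurve

/-! ### Interpolation and numerical differentiation at the nodes `-n, …, n` -/

section Nodes

/-- The nodes `-n, …, n`. -/
abbrev nodes (n : ℕ) : Finset ℤ := Finset.Icc (-(n : ℤ)) n

/-- The Lagrange basis polynomials at the nodes `-n, …, n`. -/
def nodeBasis (n : ℕ) (k : ℤ) : Polynomial ℝ := Lagrange.basis (nodes n) (fun j : ℤ => (j : ℝ)) k

/-- The weights of the central difference formula `f'(0) ≈ ∑ wₖ f(k)`. -/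
def diffWeight (n : ℕ) (k : ℤ) : ℝ := (nodeBasis n k).derivative.eval 0

lemma card_nodes (n : ℕ) : (nodes n).card = 2 * n + 1 := by
  simp; omega

lemma injOn_intCast (S : Set ℤ) : Set.InjOn (fun j : ℤ => (j : ℝ)) S :=
  Int.cast_injective.injOn

lemma degree_nodeBasis {n : ℕ} {k : ℤ} (hk : k ∈ nodes n) :
    (nodeBasis n k).degree < (2 * n + 1 : ℕ) := by
  rw [nodeBasis, Lagrange.degree_basis (injOn_intCast _) hk, card_nodes]
  exact_mod_cast Nat.lt_succ_self _

variable {E : Type*} [NormedAddCommGroup E] [NormedSpace ℝ E]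

/-- The polynomial curve of degree at most `2 n` through the points `a k` at the
integer times `k`, `|k| ≤ n`. -/
def nodeInterp (n : ℕ) (a : ℤ → E) (s : ℝ) : E := ∑ k ∈ nodes n, (nodeBasis n k).eval s • a k

lemma nodeInterp_mem (n : ℕ) (a : ℤ → E) : nodeInterp n a ∈ polyCurve E (2 * n + 1) :=
  sum_eval_smul_mem_polyCurve (fun _ hk => degree_nodeBasis hk) a

lemma nodeInterp_node {n : ℕ} (a : ℤ → E) {k : ℤ} (hk : k ∈ nodes n) :
    nodeInterp n a k = a k := by
  rw [nodeInterp, Finset.sum_eq_single k]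
  · have := Lagrange.eval_basis_self (injOn_intCast (nodes n : Set ℤ)) hk
    simp only [nodeBasis, this, one_smul]
  · intro j _ hj
    have := Lagrange.eval_basis_of_ne (v := fun j : ℤ => (j : ℝ)) hj hk
    simp only [nodeBasis, this, zero_smul]
  · exact fun h => (h hk).elim

lemma nodeInterp_eq_of_mem {n : ℕ} {f : ℝ → E} (hf : f ∈ polyCurve E (2 * n + 1)) :
    nodeInterp n (fun k => f k) = f := by
  ext s
  rw [← card_nodes] at hf
  exact (polyCurve_eq_lagrange (injOn_intCast _) hf s).symm

lemma hasDerivAt_nodeInterp (n : ℕ) (a : ℤ → E) (s : ℝ) :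
    HasDerivAt (nodeInterp n a) (∑ k ∈ nodes n, (nodeBasis n k).derivative.eval s • a k) s := by
  unfold nodeInterp
  exact HasDerivAt.fun_sum fun k _ => ((nodeBasis n k).hasDerivAt s).smul_const _

/-- The central difference formula is exact for polynomials of degree at most `2 n`. -/
lemma sum_diffWeight_smul {n : ℕ} {f : ℝ → E} (hf : f ∈ polyCurve E (2 * n + 1)) (s : ℝ) :
    ∑ k ∈ nodes n, diffWeight n k • f (s + k) = deriv f s := by
  have h1 : (fun t => f (t + s)) ∈ polyCurve E (2 * n + 1) := polyCurve_comp_add hf s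
  have h2 := hasDerivAt_nodeInterp n (fun k => f ((k : ℝ) + s)) 0
  have h3 := nodeInterp_eq_of_mem h1
  rw [h3] at h2
  have h4 := h2.deriv
  rw [deriv_comp_add_const, zero_add] at h4
  simp only [h4, diffWeight, add_comm s]

lemma sum_diffWeight (n : ℕ) : ∑ k ∈ nodes n, diffWeight n k = 0 := by
  have := sum_diffWeight_smul (n := n) (f := fun s => (1 : Polynomial ℝ).eval s • (1 : ℝ))
    (eval_smul_mem_polyCurve (by rw [Polynomial.degree_one]; exact_mod_cast Nat.succ_pos _) _) 0
  simpa using this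

lemma sum_diffWeight_mul {n : ℕ} (hn : 1 ≤ n) : ∑ k ∈ nodes n, diffWeight n k * k = 1 := by
  have := sum_diffWeight_smul (n := n)
    (f := fun s => (Polynomial.X : Polynomial ℝ).eval s • (1 : ℝ))
    (eval_smul_mem_polyCurve (by rw [Polynomial.degree_X]; exact_mod_cast (by omega)) _) 0
  simpa using this

end Nodes

/-! ### Taylor approximation along slow curves -/

section Taylor

variable {E : Type*} [NormedAddCommGroup E] [NormedSpace ℝ E]

lemma taylorWithinEval_mem_polyCurve (f : ℝ → E) (m : ℕ) (s : Set ℝ) (a : ℝ) :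
    taylorWithinEval f m s a ∈ polyCurve E (m + 1) := by
  have : taylorWithinEval f m s a = fun x => ∑ k ∈ Finset.range (m + 1),
      (Polynomial.C ((k.factorial : ℝ)⁻¹) * (Polynomial.X - Polynomial.C a) ^ k).eval x •
        iteratedDerivWithin k f s a := by
    ext x
    rw [taylor_within_apply]
    simp
  rw [this]
  refine sum_eval_smul_mem_polyCurve (fun k hk => ?_) _
  refine Polynomial.degree_le_natDegree.trans_lt ?_
  have h := Polynomial.natDegree_C_mul_le ((k.factorial : ℝ)⁻¹)
    ((Polynomial.X - Polynomial.C a) ^ k)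
  rw [Polynomial.natDegree_pow, Polynomial.natDegree_X_sub_C, mul_one] at h
  have := h.trans_lt (Finset.mem_range.1 hk)
  exact_mod_cast this

/-- If a curve `p` varies slowly, in the sense that its `i`-th derivative is of order `ηⁱ`, and `u`
is of order `η` together with its derivatives, then along `p` the map `u` is
a polynomial of degree less than `m` up to an error of order `η ^ (m + 1)`. -/
lemma exists_polyCurve_approx_comp {m : ℕ} {u : E → E} {B : Set E} (hB : IsOpen B)
    {η A C : ℝ} (hη : 0 ≤ η) (hC : 0 ≤ C) (hA : 0 ≤ A)
    (hu : ContDiffOn ℝ m u B) (hub : ∀ i ≤ m, ∀ y ∈ B, ‖iteratedFDeriv ℝ i u y‖ ≤ C * η)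
    {p : ℝ → E} (hp : ContDiff ℝ m p) {a b : ℝ} (hab : a < b)
    (hpB : ∀ s ∈ Icc a b, p s ∈ B)
    (hpb : ∀ i, 1 ≤ i → i ≤ m → ∀ s ∈ Icc a b, ‖iteratedDeriv i p s‖ ≤ (A * η) ^ i) :
    ∃ T ∈ polyCurve E m, ∀ s ∈ Icc a b,
      ‖u (p s) - T s‖ ≤ m.factorial * C * A ^ m * (b - a) ^ m * η ^ (m + 1) := by
  have hbd : ∀ s ∈ Icc a b, ‖iteratedDerivWithin m (u ∘ p) (Icc a b) s‖
      ≤ m.factorial * (C * η) * (A * η) ^ m := by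
    intro s hs
    rw [← norm_iteratedFDerivWithin_eq_norm_iteratedDerivWithin]
    refine norm_iteratedFDerivWithin_comp_le hu hp.contDiffOn le_rfl hB.uniqueDiffOn
      (uniqueDiffOn_Icc hab) hpB hs ?_ ?_
    · intro i hi
      rw [iteratedFDerivWithin_of_isOpen i hB (hpB s hs)]
      exact hub i hi _ (hpB s hs)
    · intro i h1 hi
      rw [norm_iteratedFDerivWithin_eq_norm_iteratedDerivWithin,
        iteratedDerivWithin_eq_iteratedDeriv (uniqueDiffOn_Icc hab)
          ((hp.of_le (by exact_mod_cast hi)).contDiffAt) hs]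
      exact hpb i h1 hi s hs
  have hK : (m.factorial * (C * η) * (A * η) ^ m) = m.factorial * C * A ^ m * η ^ (m + 1) := by
    ring
  rw [hK] at hbd
  have h0 : 0 ≤ m.factorial * C * A ^ m * η ^ (m + 1) := by positivity
  rcases m with _ | m
  · refine ⟨0, Submodule.zero_mem _, fun s hs => ?_⟩
    simpa using hbd s hs
  · refine ⟨_, taylorWithinEval_mem_polyCurve (u ∘ p) m (Icc a b) a, fun s hs => ?_⟩
    have := taylor_mean_remainder_bound hab.le (f := u ∘ p) (n := m)
      (hu.comp hp.contDiffOn hpB) hs hbd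
    refine this.trans ?_
    have hsa : (s - a) ^ (m + 1) ≤ (b - a) ^ (m + 1) :=
      pow_le_pow_left₀ (by linarith [hs.1]) (by linarith [hs.2]) _
    have hsa0 : 0 ≤ (s - a) ^ (m + 1) := pow_nonneg (by linarith [hs.1]) _
    have hf : (1 : ℝ) ≤ m.factorial := by exact_mod_cast m.factorial_pos
    calc _ ≤ _ / (1 : ℝ) := by
          apply div_le_div_of_nonneg_left _ one_pos hf
          exact mul_nonneg h0 hsa0
      _ ≤ ((m + 1).factorial * C * A ^ (m + 1) * η ^ (m + 1 + 1)) * (b - a) ^ (m + 1) := by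
          rw [div_one]; exact mul_le_mul_of_nonneg_left hsa h0
      _ = _ := by ring

end Taylor

/-! ### Newton interpolation -/

section Newton

/-- The polynomial `s ↦ s (s - 1) ⋯ (s - i + 1) / i!`. -/
def binomPoly (i : ℕ) : Polynomial ℝ :=
  Polynomial.C ((i.factorial : ℝ)⁻¹) * descPochhammer ℝ i

lemma binomPoly_eval_nat (i k : ℕ) : (binomPoly i).eval (k : ℝ) = k.choose i := by
  rw [binomPoly, Polynomial.eval_C_mul, descPochhammer_eval_eq_descFactorial,
    Nat.descFactorial_eq_factorial_mul_choose]
  have : (i.factorial : ℝ) ≠ 0 := by exact_mod_cast i.factorial_ne_zero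
  push_cast
  field_simp

lemma natDegree_binomPoly_le (i : ℕ) : (binomPoly i).natDegree ≤ i :=
  (Polynomial.natDegree_C_mul_le _ _).trans (descPochhammer_natDegree (R := ℝ) i).le

/-- A common bound on a compact interval for finitely many binomial polynomials and their
derivatives. -/
lemma exists_bound_binomPoly (m : ℕ) (L : ℝ) :
    ∃ M : ℝ, 1 ≤ M ∧ ∀ i ≤ m, ∀ j ≤ m, ∀ s ∈ Icc (-L) L,
      |((Polynomial.derivative^[j] (binomPoly i))).eval s| ≤ M := by
  have h : ∀ i j, ∃ M : ℝ, ∀ s ∈ Icc (-L) L,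
      |((Polynomial.derivative^[j] (binomPoly i))).eval s| ≤ M := by
    intro i j
    obtain ⟨M, hM⟩ := (isCompact_Icc (a := -L) (b := L)).exists_bound_of_continuousOn
      (f := fun s => ((Polynomial.derivative^[j] (binomPoly i))).eval s)
      (Polynomial.continuous _).continuousOn
    exact ⟨M, hM⟩
  choose M hM using h
  refine ⟨1 + ∑ i ∈ Finset.range (m + 1), ∑ j ∈ Finset.range (m + 1), |M i j|,
    by have : 0 ≤ ∑ i ∈ Finset.range (m + 1), ∑ j ∈ Finset.range (m + 1), |M i j| := by positivity
       linarith, ?_⟩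
  intro i hi j hj s hs
  have h1 : |M i j| ≤ ∑ j ∈ Finset.range (m + 1), |M i j| :=
    Finset.single_le_sum (f := fun j => |M i j|) (fun _ _ => abs_nonneg _)
      (Finset.mem_range.2 (by omega))
  have h2 : ∑ j ∈ Finset.range (m + 1), |M i j|
      ≤ ∑ i ∈ Finset.range (m + 1), ∑ j ∈ Finset.range (m + 1), |M i j| :=
    Finset.single_le_sum (f := fun i => ∑ j ∈ Finset.range (m + 1), |M i j|)
      (fun _ _ => by positivity) (Finset.mem_range.2 (by omega))
  linarith [hM i j s hs, le_abs_self (M i j)]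

variable {E : Type*} [NormedAddCommGroup E] [NormedSpace ℝ E]

/-- The Newton form of the polynomial curve of degree at most `m` through `y 0, …, y m`. -/
def newtonCurve (m : ℕ) (y : ℕ → E) (s : ℝ) : E :=
  ∑ i ∈ Finset.range (m + 1), (binomPoly i).eval s • (fwdDiff 1)^[i] y 0

lemma newtonCurve_mem (m : ℕ) (y : ℕ → E) : newtonCurve m y ∈ polyCurve E (m + 1) := by
  refine sum_eval_smul_mem_polyCurve (fun i hi => ?_) _
  refine Polynomial.degree_le_natDegree.trans_lt ?_
  have := (natDegree_binomPoly_le i).trans_lt (Finset.mem_range.1 hi)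
  exact_mod_cast this

lemma newtonCurve_nat {m k : ℕ} (hk : k ≤ m) (y : ℕ → E) : newtonCurve m y k = y k := by
  have := shift_eq_sum_fwdDiff_iter 1 y k 0
  rw [newtonCurve]
  simp only [zero_add, smul_eq_mul, mul_one] at this
  rw [this]
  simp only [binomPoly_eval_nat]
  rw [← Finset.sum_subset (Finset.range_mono (Nat.succ_le_succ hk))]
  · refine Finset.sum_congr rfl fun i _ => ?_
    rw [Nat.cast_smul_eq_nsmul]
  · intro i _ hi
    have : k < i := by simpa [Nat.lt_succ_iff] using hi
    rw [Nat.choose_eq_zero_of_lt this]; simp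

lemma iteratedDeriv_newtonCurve (m : ℕ) (y : ℕ → E) (j : ℕ) :
    iteratedDeriv j (newtonCurve m y) = fun s => ∑ i ∈ Finset.range (m + 1),
      (Polynomial.derivative^[j] (binomPoly i)).eval s • (fwdDiff 1)^[i] y 0 := by
  induction j with
  | zero => ext s; simp [newtonCurve]
  | succ j ih =>
    rw [iteratedDeriv_succ, ih]
    ext s
    refine HasDerivAt.deriv ?_
    refine HasDerivAt.fun_sum fun i _ => ?_
    rw [Function.iterate_succ_apply']
    exact (Polynomial.hasDerivAt _ s).smul_const _

/-- If the finite differences `Δⁱ y` are of order `ηⁱ`, then so are the derivatives of the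
interpolating curve. -/
lemma norm_iteratedDeriv_newtonCurve_le {m : ℕ} {L M : ℝ} (hM1 : 1 ≤ M)
    (hM : ∀ i ≤ m, ∀ j ≤ m, ∀ s ∈ Icc (-L) L,
      |((Polynomial.derivative^[j] (binomPoly i))).eval s| ≤ M)
    {y : ℕ → E} {A η : ℝ} (hA : 1 ≤ A) (hη : 0 ≤ η) (hη1 : η ≤ 1)
    (hy : ∀ i, 1 ≤ i → i ≤ m → ‖(fwdDiff 1)^[i] y 0‖ ≤ A * η ^ i)
    {j : ℕ} (hj1 : 1 ≤ j) (hjm : j ≤ m) {s : ℝ} (hs : s ∈ Icc (-L) L) :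
    ‖iteratedDeriv j (newtonCurve m y) s‖ ≤ ((m + 1) * M * A * η) ^ j := by
  rw [iteratedDeriv_newtonCurve]
  have hterm : ∀ i ∈ Finset.range (m + 1),
      ‖(Polynomial.derivative^[j] (binomPoly i)).eval s • (fwdDiff 1)^[i] y 0‖
        ≤ M * A * η ^ j := by
    intro i hi
    have him : i ≤ m := Nat.lt_succ_iff.1 (Finset.mem_range.1 hi)
    by_cases hij : i < j
    · rw [Polynomial.iterate_derivative_eq_zero ((natDegree_binomPoly_le i).trans_lt hij)]
      simp only [Polynomial.eval_zero, zero_smul, norm_zero]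
      positivity
    · push Not at hij
      rw [norm_smul, Real.norm_eq_abs, mul_assoc]
      refine mul_le_mul (hM i him j hjm s hs) ((hy i (hj1.trans hij) him).trans ?_)
        (norm_nonneg _) (by linarith)
      exact mul_le_mul_of_nonneg_left (pow_le_pow_of_le_one hη hη1 hij) (by linarith)
  refine (norm_sum_le_of_le _ hterm).trans ?_
  rw [Finset.sum_const, Finset.card_range, nsmul_eq_mul, mul_pow]
  have h1 : (1 : ℝ) ≤ (m + 1) * M * A := by
    have : (1 : ℝ) ≤ (m : ℝ) + 1 := by linarith [(Nat.cast_nonneg m : (0 : ℝ) ≤ m)]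
    exact one_le_mul_of_one_le_of_one_le (one_le_mul_of_one_le_of_one_le this hM1) hA
  have h2 := le_self_pow₀ h1 (by omega : j ≠ 0)
  calc ((m + 1 : ℕ) : ℝ) * (M * A * η ^ j) = ((m + 1) * M * A) * η ^ j := by push_cast; ring
    _ ≤ _ := mul_le_mul_of_nonneg_right h2 (by positivity)

lemma norm_newtonCurve_sub_le {m : ℕ} {L M : ℝ}
    (hM : ∀ i ≤ m, ∀ j ≤ m, ∀ s ∈ Icc (-L) L,
      |((Polynomial.derivative^[j] (binomPoly i))).eval s| ≤ M) (hM1 : 1 ≤ M)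
    {y : ℕ → E} {A η : ℝ} (hA : 1 ≤ A) (hη : 0 ≤ η) (hη1 : η ≤ 1)
    (hy : ∀ i, 1 ≤ i → i ≤ m → ‖(fwdDiff 1)^[i] y 0‖ ≤ A * η ^ i)
    {s : ℝ} (hs : s ∈ Icc (-L) L) :
    ‖newtonCurve m y s - y 0‖ ≤ (m + 1) * M * A * η := by
  rw [newtonCurve, Finset.sum_range_succ']
  have h0 : (binomPoly 0).eval s • (fwdDiff 1)^[0] y 0 = y 0 := by simp [binomPoly]
  rw [h0, add_sub_cancel_right]
  have hterm : ∀ i ∈ Finset.range m,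
      ‖(binomPoly (i + 1)).eval s • (fwdDiff 1)^[i + 1] y 0‖ ≤ M * A * η := by
    intro i hi
    have him : i + 1 ≤ m := Finset.mem_range.1 hi
    rw [norm_smul, Real.norm_eq_abs, mul_assoc]
    refine mul_le_mul (hM (i + 1) him 0 (Nat.zero_le _) s hs) ((hy (i + 1) (by omega) him).trans ?_)
      (norm_nonneg _) (by linarith)
    exact mul_le_mul_of_nonneg_left (pow_le_of_le_one hη hη1 (by omega)) (by linarith)
  refine (norm_sum_le_of_le _ hterm).trans ?_
  rw [Finset.sum_const, Finset.card_range, nsmul_eq_mul]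
  have : 0 ≤ M * A * η := by positivity
  nlinarith

end Newton

/-! ### Finite differences along an orbit -/

section Differences

variable {E : Type*} [NormedAddCommGroup E] [NormedSpace ℝ E]

/-- Along an orbit of `id + u`, with `u` and its derivatives up to order `N` of order `η`,
the `i`-th finite difference is of order `ηⁱ`. The induction step uses that
`Δ^(m+1) y = Δ^m (u ∘ y)` and that `u ∘ y` is, up to order `η^(m+1)`,
a polynomial of degree less than `m`. -/
lemma exists_bound_fwdDiff_orbit (N : ℕ) {C : ℝ} (hC : 0 ≤ C) (m : ℕ) (hm : m ≤ N + 1) :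
    ∃ A : ℝ, 1 ≤ A ∧ ∀ (r η : ℝ) (x : E) (u : E → E), 0 ≤ η → η ≤ 1 → A * η < r / 2 →
      ContDiffOn ℝ N u (ball x r) →
      (∀ i ≤ N, ∀ z ∈ ball x r, ‖iteratedFDeriv ℝ i u z‖ ≤ C * η) →
      ∀ y : ℕ → E, y 0 ∈ ball x (r / 2) → (∀ i < m, y (i + 1) = y i + u (y i)) →
        ∀ i, 1 ≤ i → i ≤ m → ‖(fwdDiff 1)^[i] y 0‖ ≤ A * η ^ i := by
  induction m with
  | zero => exact ⟨1, le_rfl, fun _ _ _ _ _ _ _ _ _ _ _ _ i h1 h2 => by omega⟩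
  | succ m ih =>
    obtain ⟨A, hA1, hA⟩ := ih (by omega)
    obtain ⟨M, hM1, hM⟩ := exists_bound_binomPoly m (m + 1)
    set A' : ℝ := (m + 1) * M * A with hA'
    set K : ℝ := m.factorial * C * A' ^ m * ((m + 1 : ℝ) - 0) ^ m with hK
    set W : ℝ := ∑ k ∈ Finset.range (m + 1), |(((-1 : ℤ) ^ (m - k) * m.choose k : ℤ) : ℝ)| with hW
    have hAA' : A ≤ A' := by
      have : (1 : ℝ) ≤ (m + 1) * M :=
        one_le_mul_of_one_le_of_one_le (by linarith [(Nat.cast_nonneg m : (0 : ℝ) ≤ m)]) hM1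
      exact le_mul_of_one_le_left (by linarith) this
    have hA'0 : 0 ≤ A' := by linarith
    have hK0 : 0 ≤ K := by rw [hK, sub_zero]; positivity
    have hW0 : 0 ≤ W := by positivity
    refine ⟨A' + W * K, by nlinarith [mul_nonneg hW0 hK0], ?_⟩
    intro r η x u hη hη1 hsmall hu hub y hy0 hy
    have hWK : 0 ≤ W * K := mul_nonneg hW0 hK0
    have hA'η : A' * η < r / 2 := by nlinarith
    have hprev := hA r η x u hη hη1 (by nlinarith) hu hub y hy0 (fun i hi => hy i (by omega))
    intro i hi1 him
    rcases Nat.lt_or_ge i (m + 1) with him' | him'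
    · refine (hprev i hi1 (by omega)).trans ?_
      exact mul_le_mul_of_nonneg_right (by linarith) (by positivity)
    obtain rfl : i = m + 1 := by omega
    have hsub : Icc (0 : ℝ) (m + 1) ⊆ Icc (-((m : ℝ) + 1)) (m + 1) :=
      Icc_subset_Icc (by linarith [(Nat.cast_nonneg m : (0 : ℝ) ≤ m)]) le_rfl
    obtain ⟨T, hT, hTb⟩ := exists_polyCurve_approx_comp (m := m) (u := u) isOpen_ball hη hC hA'0
      (hu.of_le (by exact_mod_cast (by omega : m ≤ N))) (fun i hi => hub i (by omega))
      (polyCurve_contDiff (newtonCurve_mem m y)) (a := 0) (b := m + 1)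
      (by linarith [(Nat.cast_nonneg m : (0 : ℝ) ≤ m)])
      (fun s hs => by
        have h1 := norm_newtonCurve_sub_le hM hM1 hA1 hη hη1 hprev (hsub hs)
        rw [← dist_eq_norm] at h1
        rw [mem_ball] at hy0 ⊢
        have h2 := dist_triangle (newtonCurve m y s) (y 0) x
        linarith)
      (fun j hj1 hjm s hs => norm_iteratedDeriv_newtonCurve_le hM1 hM hA1 hη hη1 hprev hj1 hjm
        (hsub hs))
    have hstep : (fwdDiff 1)^[m + 1] y 0 = ∑ k ∈ Finset.range (m + 1),
        ((-1 : ℤ) ^ (m - k) * m.choose k) • (u (newtonCurve m y k) - T k) := by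
      simp only [smul_sub, Finset.sum_sub_distrib]
      rw [polyCurve_alternating_sum hT, sub_zero, Function.iterate_succ_apply,
        fwdDiff_iter_eq_sum_shift]
      refine Finset.sum_congr rfl fun k hk => ?_
      have hk' := Finset.mem_range.1 hk
      rw [newtonCurve_nat (by omega)]
      simp [fwdDiff, hy k hk']
    rw [hstep]
    have hterm : ∀ k ∈ Finset.range (m + 1),
        ‖((-1 : ℤ) ^ (m - k) * m.choose k) • (u (newtonCurve m y k) - T k)‖ ≤
          |(((-1 : ℤ) ^ (m - k) * m.choose k : ℤ) : ℝ)| * (K * η ^ (m + 1)) := by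
      intro k hk
      have hk' : k ≤ m := Nat.lt_succ_iff.1 (Finset.mem_range.1 hk)
      rw [← Int.cast_smul_eq_zsmul ℝ, norm_smul, Real.norm_eq_abs]
      refine mul_le_mul_of_nonneg_left (hTb k ⟨by positivity, ?_⟩) (abs_nonneg _)
      have : (k : ℝ) ≤ m := by exact_mod_cast hk'
      linarith
    refine (norm_sum_le_of_le _ hterm).trans ?_
    rw [← Finset.sum_mul, ← hW, ← mul_assoc]
    exact mul_le_mul_of_nonneg_right (by linarith) (by positivity)

end Differences

/-! ### The interpolating curve as an approximate orbit -/

section Residual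

variable {E : Type*} [NormedAddCommGroup E] [NormedSpace ℝ E]

/-- A polynomial curve is controlled on a compact interval by its values at sufficiently many
nodes. -/
lemma exists_polyCurve_bound_of_nodes (E : Type*) [NormedAddCommGroup E] [NormedSpace ℝ E]
    (d : ℕ) (a b : ℝ) :
    ∃ Λ : ℝ, 0 ≤ Λ ∧ ∀ f ∈ polyCurve E d, ∀ R : ℝ, (∀ k < d, ‖f (k : ℝ)‖ ≤ R) →
      ∀ s ∈ Icc a b, ‖f s‖ ≤ Λ * R := by
  set ℓ : ℕ → Polynomial ℝ := Lagrange.basis (Finset.range d) (fun k : ℕ => (k : ℝ))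
  have h : ∀ k, ∃ M : ℝ, ∀ s ∈ Icc a b, |(ℓ k).eval s| ≤ M := by
    intro k
    exact isCompact_Icc.exists_bound_of_continuousOn
      (f := fun s => (ℓ k).eval s) (Polynomial.continuous _).continuousOn
  choose M hM using h
  refine ⟨∑ k ∈ Finset.range d, |M k|, by positivity, fun f hf R hR s hs => ?_⟩
  have hc : d = (Finset.range d).card := by simp
  rw [hc] at hf
  rw [polyCurve_eq_lagrange (v := fun k : ℕ => (k : ℝ)) Nat.cast_injective.injOn hf s,
    Finset.sum_mul]
  refine norm_sum_le_of_le _ fun k hk => ?_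
  rw [norm_smul, Real.norm_eq_abs]
  exact mul_le_mul ((hM k s hs).trans (le_abs_self _)) (hR k (Finset.mem_range.1 hk))
    (norm_nonneg _) (abs_nonneg _)

/-- The curve interpolating `2 n + 1` successive points of an orbit of `id + u` is advanced
by `id + u` as an orbit of the map is, also between the nodes, up to order `η^(2 n + 1)`.
Indeed the defect is a polynomial of degree less than `2 n` up to that order, and it vanishes
at `2 n` nodes. -/
lemma exists_bound_interp_defect (E : Type*) [NormedAddCommGroup E] [NormedSpace ℝ E]
    {n : ℕ} (hn : 1 ≤ n) {C : ℝ} (hC : 0 ≤ C) :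
    ∃ A K : ℝ, 1 ≤ A ∧ 0 ≤ K ∧ ∀ (r η : ℝ) (x : E) (u : E → E), 0 ≤ η → η ≤ 1 → A * η < r / 2 →
      ContDiffOn ℝ (2 * n : ℕ) u (ball x r) →
      (∀ i ≤ 2 * n, ∀ z ∈ ball x r, ‖iteratedFDeriv ℝ i u z‖ ≤ C * η) →
      ∀ a : ℤ → E, a (-n) ∈ ball x (r / 2) → (∀ k ∈ Ico (-(n : ℤ)) n, a (k + 1) = a k + u (a k)) →
        ∀ s ∈ Icc (-(n : ℝ)) n, ‖nodeInterp n a s - a (-n)‖ ≤ A * η ∧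
          ‖u (nodeInterp n a s) - (nodeInterp n a (s + 1) - nodeInterp n a s)‖
            ≤ K * η ^ (2 * n + 1) := by
  obtain ⟨A, hA1, hA⟩ := exists_bound_fwdDiff_orbit (E := E) (2 * n) hC (2 * n) (by omega)
  obtain ⟨M, hM1, hM⟩ := exists_bound_binomPoly (2 * n) (2 * n)
  obtain ⟨Λ, hΛ0, hΛ⟩ := exists_polyCurve_bound_of_nodes E (2 * n) 0 (2 * n)
  have hn0 : (1 : ℝ) ≤ n := by exact_mod_cast hn
  set A' : ℝ := ((2 * n : ℕ) + 1) * M * A with hA'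
  set K : ℝ := (2 * n).factorial * C * A' ^ (2 * n) * ((2 * n : ℝ) - 0) ^ (2 * n) with hK
  have hAA' : A ≤ A' := by
    have : (1 : ℝ) ≤ ((2 * n : ℕ) + 1) * M :=
      one_le_mul_of_one_le_of_one_le (by linarith [(Nat.cast_nonneg (2 * n) : (0 : ℝ) ≤ _)]) hM1
    exact le_mul_of_one_le_left (by linarith) this
  have hA'0 : 0 ≤ A' := by linarith
  have hK0 : 0 ≤ K := by rw [hK, sub_zero]; positivity
  refine ⟨A', (1 + Λ) * K, hA1.trans hAA', by positivity, ?_⟩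
  intro r η x u hη hη1 hsmall hu hub a ha0 ha
  set y : ℕ → E := fun i => a ((i : ℤ) - n) with hy
  have hy0 : y 0 = a (-n) := by simp [hy]
  have hystep : ∀ i < 2 * n, y (i + 1) = y i + u (y i) := by
    intro i hi
    have := ha ((i : ℤ) - n) ⟨by omega, by omega⟩
    rw [← this]; simp only [hy]; congr 1; push_cast; ring
  have hdiff := hA r η x u hη hη1 (by nlinarith) hu hub y (by rwa [hy0]) hystep
  set p := newtonCurve (2 * n) y with hp
  have hpmem : p ∈ polyCurve E (2 * n + 1) := newtonCurve_mem _ _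
  have hsub : Icc (0 : ℝ) (2 * n) ⊆ Icc (-(2 * n : ℝ)) (2 * n) :=
    Icc_subset_Icc (by linarith) le_rfl
  have hnear : ∀ s ∈ Icc (0 : ℝ) (2 * n), ‖p s - y 0‖ ≤ A' * η := fun s hs =>
    norm_newtonCurve_sub_le hM hM1 hA1 hη hη1 hdiff (hsub hs)
  obtain ⟨T, hT, hTb⟩ := exists_polyCurve_approx_comp (m := 2 * n) (u := u) isOpen_ball hη hC hA'0
    hu hub (polyCurve_contDiff hpmem) (a := 0) (b := 2 * n) (by linarith)
    (fun s hs => by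
      have h1 := hnear s hs
      rw [← dist_eq_norm, hy0] at h1
      rw [mem_ball] at ha0 ⊢
      linarith [dist_triangle (p s) (a (-n)) x])
    (fun j hj1 hjm s hs => norm_iteratedDeriv_newtonCurve_le hM1 hM hA1 hη hη1 hdiff hj1 hjm
      (hsub hs))
  have hD : (fun s => p (s + 1) - p s) - T ∈ polyCurve E (2 * n) :=
    Submodule.sub_mem _ (polyCurve_shift_sub hpmem) hT
  have hDnode : ∀ k < 2 * n,
      ‖((fun s => p (s + 1) - p s) - T) (k : ℝ)‖ ≤ K * η ^ (2 * n + 1) := by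
    intro k hk
    have h1 : p (k : ℝ) = y k := newtonCurve_nat hk.le y
    have h2 : p ((k : ℝ) + 1) = y (k + 1) := by
      exact_mod_cast newtonCurve_nat (Nat.succ_le_of_lt hk) y
    have hk' : (k : ℝ) ≤ 2 * n := by exact_mod_cast hk.le
    have h3 := hTb k ⟨by positivity, hk'⟩
    rw [h1] at h3
    simpa only [Pi.sub_apply, h1, h2, hystep k hk, add_sub_cancel_left] using h3
  have hq : ∀ s, nodeInterp n a s = p (s + n) := by
    intro s
    have h1 := nodeInterp_eq_of_mem (polyCurve_comp_add hpmem (n : ℝ))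
    rw [← congr_fun h1 s]
    refine Finset.sum_congr rfl fun k hk => ?_
    congr 1
    rw [Finset.mem_Icc] at hk
    obtain ⟨i, hi⟩ := Int.eq_ofNat_of_zero_le (by omega : 0 ≤ k + n)
    have h2 : (k : ℝ) + n = (i : ℕ) := by exact_mod_cast hi
    change a k = p ((k : ℝ) + n)
    rw [h2, hp, newtonCurve_nat (by omega)]
    simp only [hy]
    congr 1; omega
  intro s hs
  have hs' : s + n ∈ Icc (0 : ℝ) (2 * n) := ⟨by linarith [hs.1], by linarith [hs.2]⟩
  rw [hq, hq, add_right_comm, ← hy0]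
  refine ⟨hnear _ hs', ?_⟩
  have h1 := hTb _ hs'
  have h2 := hΛ _ hD _ hDnode _ hs'
  have h3 : u (p (s + n)) - (p (s + n + 1) - p (s + n)) =
      (u (p (s + n)) - T (s + n)) - ((fun s => p (s + 1) - p s) - T) (s + n) := by
    simp only [Pi.sub_apply]; abel
  rw [h3]
  refine (norm_sub_le _ _).trans ?_
  calc _ ≤ K * η ^ (2 * n + 1) + Λ * (K * η ^ (2 * n + 1)) := add_le_add h1 h2
    _ = _ := by ring

end Residual

/-! ### Two-sided orbits of maps near the identity -/

section Orbits

variable {E : Type*} [NormedAddCommGroup E]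

lemma norm_sub_zero_le_of_increments {n : ℕ} {c : ℤ → E} {δ : ℝ}
    (h : ∀ k ∈ Ico (-(n : ℤ)) n, ‖c (k + 1) - c k‖ ≤ δ) :
    ∀ k ∈ Icc (-(n : ℤ)) n, ‖c k - c 0‖ ≤ n * δ := by
  have key : ∀ j : ℕ, j ≤ n → ‖c j - c 0‖ ≤ j * δ ∧ ‖c (-j) - c 0‖ ≤ j * δ := by
    intro j
    induction j with
    | zero => simp
    | succ j ih =>
      intro hj
      obtain ⟨h1, h2⟩ := ih (by omega)
      have h3 := h j ⟨by omega, by omega⟩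
      have h4 := h (-((j + 1 : ℕ) : ℤ)) ⟨by omega, by omega⟩
      have e : -((j + 1 : ℕ) : ℤ) + 1 = -j := by push_cast; ring
      rw [e] at h4
      constructor
      · have : c ((j + 1 : ℕ) : ℤ) - c 0 = (c ((j : ℤ) + 1) - c j) + (c j - c 0) := by
          push_cast; abel
        rw [this]
        refine (norm_add_le _ _).trans ?_
        push_cast; linarith
      · have : c (-((j + 1 : ℕ) : ℤ)) - c 0
            = (c (-(j : ℤ)) - c 0) - (c (-(j : ℤ)) - c (-((j + 1 : ℕ) : ℤ))) := by abel
        rw [this]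
        refine (norm_sub_le _ _).trans ?_
        push_cast at h4 ⊢; linarith
  intro k hk
  have hδ : 0 ≤ δ ∨ n = 0 := by
    rcases Nat.eq_zero_or_pos n with hn | hn
    · exact Or.inr hn
    · exact Or.inl ((norm_nonneg _).trans (h 0 ⟨by omega, by omega⟩))
  rcases hδ with hδ | rfl
  · obtain ⟨j, rfl | rfl⟩ := Int.eq_nat_or_neg k
    · have hj : j ≤ n := by have := hk.2; omega
      refine (key j hj).1.trans (mul_le_mul_of_nonneg_right (by exact_mod_cast hj) hδ)
    · have hj : j ≤ n := by have := hk.1; omega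
      refine (key j hj).2.trans (mul_le_mul_of_nonneg_right (by exact_mod_cast hj) hδ)
  · have : k = 0 := by have := hk.1; have := hk.2; omega
    simp [this]

/-- An orbit of `id + u` and a `δ`-pseudo-orbit stay close in both directions of time. -/
lemma norm_orbit_sub_pseudoOrbit_le {n : ℕ} {u : E → E} {B : Set E} {δ : ℝ} (hδ : 0 ≤ δ)
    (hL : ∀ z ∈ B, ∀ w ∈ B, ‖u z - u w‖ ≤ 1 / 2 * ‖z - w‖) {a b : ℤ → E}
    (haB : ∀ k ∈ Ico (-(n : ℤ)) n, a k ∈ B) (hbB : ∀ k ∈ Ico (-(n : ℤ)) n, b k ∈ B)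
    (ha : ∀ k ∈ Ico (-(n : ℤ)) n, a (k + 1) = a k + u (a k))
    (hb : ∀ k ∈ Ico (-(n : ℤ)) n, ‖u (b k) - (b (k + 1) - b k)‖ ≤ δ) :
    ∀ k ∈ Icc (-(n : ℤ)) n, ‖a k - b k‖ ≤ 4 ^ n * (‖a 0 - b 0‖ + δ) := by
  set d := ‖a 0 - b 0‖ + δ with hd
  have hd0 : δ ≤ d := by linarith [norm_nonneg (a 0 - b 0)]
  have step : ∀ k ∈ Ico (-(n : ℤ)) n, ‖a (k + 1) - b (k + 1)‖ ≤ 2 * ‖a k - b k‖ + δ ∧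
      ‖a k - b k‖ ≤ 2 * (‖a (k + 1) - b (k + 1)‖ + δ) := by
    intro k hk
    have h1 := hL _ (haB k hk) _ (hbB k hk)
    have h2 := hb k hk
    constructor
    · have : a (k + 1) - b (k + 1)
          = (a k - b k) + (u (a k) - u (b k)) + (u (b k) - (b (k + 1) - b k)) := by
        rw [ha k hk]; abel
      rw [this]
      have := norm_add₃_le (a := a k - b k) (b := u (a k) - u (b k))
        (c := u (b k) - (b (k + 1) - b k))
      linarith [norm_nonneg (a k - b k)]
    · have : a k - b k
          = (a (k + 1) - b (k + 1)) - (u (a k) - u (b k)) - (u (b k) - (b (k + 1) - b k)) := by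
        rw [ha k hk]; abel
      have h3 := norm_sub_le ((a (k + 1) - b (k + 1)) - (u (a k) - u (b k)))
        (u (b k) - (b (k + 1) - b k))
      rw [← this] at h3
      linarith [norm_sub_le (a (k + 1) - b (k + 1)) (u (a k) - u (b k))]
  have key : ∀ j : ℕ, j ≤ n → ‖a j - b j‖ ≤ 4 ^ j * d ∧ ‖a (-j) - b (-j)‖ ≤ 4 ^ j * d := by
    intro j
    induction j with
    | zero => intro _; simp; linarith
    | succ j ih =>
      intro hj
      obtain ⟨h1, h2⟩ := ih (by omega)
      have h3 := (step j ⟨by omega, by omega⟩).1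
      have h4 := (step (-((j + 1 : ℕ) : ℤ)) ⟨by omega, by omega⟩).2
      have e : -((j + 1 : ℕ) : ℤ) + 1 = -j := by push_cast; ring
      rw [e] at h4
      have h5 : d ≤ 4 ^ j * d :=
        le_mul_of_one_le_left (hδ.trans hd0) (one_le_pow₀ (by norm_num))
      rw [pow_succ]
      push_cast at h3 h4 ⊢
      constructor <;> linarith
  intro k hk
  have hpow : ∀ j : ℕ, j ≤ n → (4 : ℝ) ^ j * d ≤ 4 ^ n * d := fun j hj =>
    mul_le_mul_of_nonneg_right (pow_le_pow_right₀ (by norm_num) hj) (hδ.trans hd0)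
  obtain ⟨j, rfl | rfl⟩ := Int.eq_nat_or_neg k
  · have hj : j ≤ n := by have := hk.2; omega
    exact (key j hj).1.trans (hpow j hj)
  · have hj : j ≤ n := by have := hk.1; omega
    exact (key j hj).2.trans (hpow j hj)

end Orbits

/-! ### The inverse branch and the iterates -/

section Iterates

variable {m : ℕ}

/-- Near a point, a map close to the identity has its near-identity inverse branch. -/
lemma localInverse_spec {D : Set (Space m)} {f : Space m → Space m} {B : Set (Space m)} {δ : ℝ}
    (hδ : 0 ≤ δ) (hBD : B ⊆ D)
    (hL : ∀ z ∈ B, ∀ w ∈ B, ‖(f z - z) - (f w - w)‖ ≤ 1 / 2 * ‖z - w‖)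
    (hb : ∀ z ∈ B, ‖f z - z‖ ≤ δ) {y : Space m} (hy : closedBall y (2 * δ) ⊆ B) :
    localInverse D f y ∈ closedBall y (2 * δ) ∧ f (localInverse D f y) = y := by
  have hyB : y ∈ B := hy (mem_closedBall_self (by linarith))
  have happ : ApproximatesLinearOn f (ContinuousLinearMap.id ℝ (Space m)) B (1 / 2) := by
    intro z hz w hw
    have := hL z hz w hw
    rw [show f z - f w - (ContinuousLinearMap.id ℝ (Space m)) (z - w)
      = (f z - z) - (f w - w) by simp; abel]
    simpa using this
  -- `toNonlinearRightInverse` of the identity would have constant `0` in dimension zero.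
  let R : (ContinuousLinearMap.id ℝ (Space m)).NonlinearRightInverse :=
    { toFun := id, nnnorm := 1, bound' := by simp, right_inv' := by simp }
  have hsurj := happ.surjOn_closedBall_of_nonlinearRightInverse R (by linarith) hy
  have hmem : y ∈ closedBall (f y)
      ((((R.nnnorm : NNReal) : ℝ)⁻¹ - (1 / 2 : NNReal)) * (2 * δ)) := by
    have h1 := hb y hyB
    have h2 : ((((R.nnnorm : NNReal) : ℝ)⁻¹ - (1 / 2 : NNReal)) * (2 * δ)) = δ := by
      simp only [R]; push_cast; ring
    rw [h2, mem_closedBall, dist_comm, dist_eq_norm]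
    exact h1
  obtain ⟨x', hx', hfx'⟩ := hsurj hmem
  have hex : ∃ x ∈ D, f x = y ∧ ∀ x' ∈ D, f x' = y → dist x y ≤ dist x' y := by
    -- a nearer preimage would lie in `B`, where `f` is injective
    refine ⟨x', hBD (hy hx'), hfx', fun w _ hw => ?_⟩
    by_contra hlt
    push Not at hlt
    have hwB : w ∈ B := hy (hlt.le.trans hx')
    have h1 := hL w hwB x' (hy hx')
    rw [hw, hfx'] at h1
    have h2 : ‖y - w - (y - x')‖ = ‖w - x'‖ := by
      rw [← norm_neg]; congr 1; abel
    rw [h2] at h1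
    have h3 : w = x' := by
      rw [← sub_eq_zero, ← norm_eq_zero]
      linarith [norm_nonneg (w - x')]
    exact absurd hlt (by rw [h3]; exact lt_irrefl _)
  have hspec := hex.choose_spec
  have hval : localInverse D f y = hex.choose := by rw [localInverse, dif_pos hex]
  rw [hval]
  exact ⟨(hspec.2.2 x' (hBD (hy hx')) hfx').trans hx', hspec.2.1⟩

lemma iter_zero (D : Set (Space m)) (f : Space m → Space m) (x : Space m) : iter D f 0 x = x := rfl

lemma iter_natCast (D : Set (Space m)) (f : Space m → Space m) (k : ℕ) :
    iter D f k = f^[k] := rfl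

lemma iter_neg_natCast (D : Set (Space m)) (f : Space m → Space m) (k : ℕ) :
    iter D f (-(k : ℤ)) = (localInverse D f)^[k] := by
  cases k with
  | zero => rfl
  | succ k => rfl

/-- Points well inside `B` have `n` iterates in both directions, which stay in `B`. -/
lemma iter_orbit {D : Set (Space m)} {f : Space m → Space m} {B : Set (Space m)} {δ : ℝ}
    (hδ : 0 ≤ δ) (hBD : B ⊆ D)
    (hL : ∀ z ∈ B, ∀ w ∈ B, ‖(f z - z) - (f w - w)‖ ≤ 1 / 2 * ‖z - w‖)
    (hb : ∀ z ∈ B, ‖f z - z‖ ≤ δ) {n : ℕ} {y : Space m}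
    (hy : closedBall y (n * (2 * δ)) ⊆ B) :
    (∀ k ∈ Icc (-(n : ℤ)) n, iter D f k y ∈ closedBall y (n * (2 * δ))) ∧
      ∀ k ∈ Ico (-(n : ℤ)) n, f (iter D f k y) = iter D f (k + 1) y := by
  have hmono : ∀ j : ℕ, j ≤ n → closedBall y (j * (2 * δ)) ⊆ closedBall y (n * (2 * δ)) :=
    fun j hj => closedBall_subset_closedBall
      (mul_le_mul_of_nonneg_right (by exact_mod_cast hj) (by linarith))
  have hfwd : ∀ j : ℕ, j ≤ n → f^[j] y ∈ closedBall y (j * (2 * δ)) := by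
    intro j
    induction j with
    | zero => simp
    | succ j ih =>
      intro hj
      have h1 := ih (by omega)
      have h2 := hb _ (hy (hmono j (by omega) h1))
      rw [← dist_eq_norm] at h2
      rw [Function.iterate_succ_apply']
      rw [mem_closedBall] at h1 ⊢
      have h3 := dist_triangle (f (f^[j] y)) (f^[j] y) y
      push_cast
      linarith
  have hinv : ∀ j : ℕ, j + 1 ≤ n → (localInverse D f)^[j] y ∈ closedBall y (j * (2 * δ)) →
      localInverse D f ((localInverse D f)^[j] y) ∈
        closedBall ((localInverse D f)^[j] y) (2 * δ) ∧
      f (localInverse D f ((localInverse D f)^[j] y)) = (localInverse D f)^[j] y := by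
    intro j hj h1
    refine localInverse_spec hδ hBD hL hb (Subset.trans ?_ (Subset.trans (hmono (j + 1) hj) hy))
    refine closedBall_subset_closedBall' ?_
    rw [mem_closedBall] at h1
    push_cast
    linarith
  have hbwd : ∀ j : ℕ, j ≤ n → (localInverse D f)^[j] y ∈ closedBall y (j * (2 * δ)) := by
    intro j
    induction j with
    | zero => simp
    | succ j ih =>
      intro hj
      have h1 := ih (by omega)
      have h2 := (hinv j hj h1).1
      rw [Function.iterate_succ_apply']
      rw [mem_closedBall] at h1 h2 ⊢
      have h3 := dist_triangle (localInverse D f ((localInverse D f)^[j] y))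
        ((localInverse D f)^[j] y) y
      push_cast
      linarith
  constructor
  · intro k hk
    obtain ⟨j, rfl | rfl⟩ := Int.eq_nat_or_neg k
    · have hj : j ≤ n := by have := hk.2; omega
      rw [iter_natCast]; exact hmono j hj (hfwd j hj)
    · have hj : j ≤ n := by have := hk.1; omega
      rw [iter_neg_natCast]; exact hmono j hj (hbwd j hj)
  · intro k hk
    rcases lt_or_ge k 0 with hk0 | hk0
    · obtain ⟨j, hj⟩ := Int.eq_ofNat_of_zero_le (by omega : 0 ≤ -k - 1)
      obtain rfl : k = -((j + 1 : ℕ) : ℤ) := by push_cast; omega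
      have hjn : j + 1 ≤ n := by have := hk.1; omega
      have e : -((j + 1 : ℕ) : ℤ) + 1 = -(j : ℤ) := by push_cast; ring
      rw [e, iter_neg_natCast, iter_neg_natCast, Function.iterate_succ_apply']
      exact (hinv j hjn (hbwd j (by omega))).2
    · obtain ⟨j, rfl⟩ := Int.eq_ofNat_of_zero_le hk0
      have e : (j : ℤ) + 1 = ((j + 1 : ℕ) : ℤ) := by push_cast; ring
      rw [e, iter_natCast, iter_natCast, Function.iterate_succ_apply']

end Iterates

/-! ### Slow Lipschitz fields -/

section ODE

variable {E : Type*} [NormedAddCommGroup E] [NormedSpace ℝ E]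

lemma hasDerivWithinAt_Ici_of_Icc {γ : ℝ → E} {γ' : E} {a b t : ℝ}
    (h : HasDerivWithinAt γ γ' (Icc a b) t) (ht : t ∈ Ico a b) :
    HasDerivWithinAt γ γ' (Ici t) t :=
  h.mono_of_mem_nhdsWithin (mem_of_superset (Icc_mem_nhdsGE ht.2) (Icc_subset_Icc_left ht.1))

/-- A solution cannot leave a ball within unit time if the field is too slow there. -/
lemma solution_mem_closedBall {g : E → E} {x : E} {ρ M : ℝ} (hρ : 0 ≤ ρ) (hMρ : M < ρ)
    (hb : ∀ y ∈ closedBall x ρ, ‖g y‖ ≤ M) {γ : ℝ → E} (h0 : γ 0 = x)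
    (hγ : ∀ t ∈ Icc (0 : ℝ) 1, HasDerivWithinAt γ (g (γ t)) (Icc 0 1) t) :
    ∀ t ∈ Icc (0 : ℝ) 1, γ t ∈ closedBall x ρ := by
  have hcont : ContinuousOn (fun t => γ t - x) (Icc 0 1) := fun t ht =>
    ((hγ t ht).continuousWithinAt).sub continuousWithinAt_const
  have key := image_norm_le_of_norm_deriv_right_lt_deriv_boundary' hcont
    (f' := fun t => g (γ t)) (B := fun t => ρ * t) (B' := fun _ => ρ)
    (fun t ht => (hasDerivWithinAt_Ici_of_Icc (hγ t ⟨ht.1, ht.2.le⟩) ht).sub_const x)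
    (by simp [h0]) (by fun_prop)
    (fun t _ => by simpa using! ((hasDerivAt_id t).const_mul ρ).hasDerivWithinAt)
    (fun t ht hB => by
      refine (hb _ ?_).trans_lt hMρ
      rw [mem_closedBall, dist_eq_norm, hB]
      nlinarith [ht.2])
  intro t ht
  rw [mem_closedBall, dist_eq_norm]
  exact (key ht).trans (by nlinarith [ht.2])

/-- The dynamics of a slow Lipschitz field near `x`: there is a solution on `[0, 1]` starting at
`x`, it stays near `x` and is unique, and an approximate solution that starts at `x`
stays close to it. -/
lemma slow_field_dynamics [CompleteSpace E] {g : E → E} {x : E} {ρ M : ℝ} (hρ : 0 ≤ ρ)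
    (hMρ : M < ρ)
    (hb : ∀ y ∈ closedBall x ρ, ‖g y‖ ≤ M)
    (hL : ∀ y ∈ closedBall x ρ, ∀ z ∈ closedBall x ρ, ‖g y - g z‖ ≤ ‖y - z‖) :
    ∃ γ : ℝ → E, γ 0 = x ∧
      (∀ t ∈ Icc (0 : ℝ) 1, HasDerivWithinAt γ (g (γ t)) (Icc 0 1) t) ∧
      (∀ t ∈ Icc (0 : ℝ) 1, γ t ∈ closedBall x ρ) ∧
      (∀ β : ℝ → E, β 0 = x →
        (∀ t ∈ Icc (0 : ℝ) 1, HasDerivWithinAt β (g (β t)) (Icc 0 1) t) → β 1 = γ 1) ∧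
      ∀ (q q' : ℝ → E) (R : ℝ), q 0 = x → (∀ t, HasDerivAt q (q' t) t) →
        (∀ t ∈ Icc (0 : ℝ) 1, q t ∈ closedBall x ρ) →
        (∀ t ∈ Icc (0 : ℝ) 1, ‖g (q t) - q' t‖ ≤ R) → ‖q 1 - γ 1‖ ≤ R * (Real.exp 1 - 1) := by
  have hM0 : 0 ≤ M := (norm_nonneg _).trans (hb x (mem_closedBall_self hρ))
  have hlip1 : LipschitzOnWith 1 g (closedBall x ρ) := by
    refine LipschitzOnWith.of_dist_le_mul fun y hy z hz => ?_
    rw [dist_eq_norm, dist_eq_norm, NNReal.coe_one, one_mul]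
    exact hL y hy z hz
  have hpl : IsPicardLindelof (fun _ => g) (⟨0, by simp⟩ : Icc (0 : ℝ) 1) x ⟨ρ, hρ⟩ 0 ⟨M, hM0⟩ 1 :=
    IsPicardLindelof.of_time_independent hb hlip1 (by
      simp only [NNReal.coe_zero, sub_zero, sub_self]
      rw [max_eq_left zero_le_one, mul_one]; exact hMρ.le)
  obtain ⟨γ, hγ0, hγ⟩ := hpl.exists_eq_forall_mem_Icc_hasDerivWithinAt₀
  have hγ0 : γ 0 = x := hγ0
  have hmem : ∀ β : ℝ → E, β 0 = x →
      (∀ t ∈ Icc (0 : ℝ) 1, HasDerivWithinAt β (g (β t)) (Icc 0 1) t) →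
      ∀ t ∈ Icc (0 : ℝ) 1, β t ∈ closedBall x ρ := fun β h0 h =>
    solution_mem_closedBall hρ hMρ hb h0 h
  have hcmp : ∀ (q q' : ℝ → E) (R : ℝ), q 0 = x → ContinuousOn q (Icc 0 1) →
        (∀ t ∈ Ico (0 : ℝ) 1, HasDerivWithinAt q (q' t) (Ici t) t) →
        (∀ t ∈ Icc (0 : ℝ) 1, q t ∈ closedBall x ρ) →
        (∀ t ∈ Icc (0 : ℝ) 1, ‖g (q t) - q' t‖ ≤ R) → ‖q 1 - γ 1‖ ≤ R * (Real.exp 1 - 1) := by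
    intro q q' R hq0 hqc hq hqm hqR
    have := dist_le_of_approx_trajectories_ODE_of_mem (v := fun _ => g)
      (s := fun _ => closedBall x ρ) (K := 1) (f := q) (g := γ) (a := 0) (b := 1)
      (f' := q') (g' := fun t => g (γ t)) (εf := R) (εg := 0) (δ := 0)
      (fun _ _ => hlip1) hqc hq
      (fun t ht => by rw [dist_comm, dist_eq_norm]; exact hqR t ⟨ht.1, ht.2.le⟩)
      (fun t ht => hqm t ⟨ht.1, ht.2.le⟩)
      (fun t ht => (hγ t ht).continuousWithinAt)
      (fun t ht => hasDerivWithinAt_Ici_of_Icc (hγ t ⟨ht.1, ht.2.le⟩) ht)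
      (fun t ht => by simp) (fun t ht => hmem γ hγ0 hγ t ⟨ht.1, ht.2.le⟩)
      (by simp [hq0, hγ0]) 1 ⟨zero_le_one, le_rfl⟩
    rw [dist_eq_norm] at this
    refine this.trans_eq ?_
    rw [gronwallBound_of_K_ne_0 (by simp)]
    simp
  refine ⟨γ, hγ0, hγ, hmem γ hγ0 hγ, fun β hβ0 hβ => ?_, fun q q' R hq0 hq hqm hqR => ?_⟩
  · have := hcmp β (fun t => g (β t)) 0 hβ0 (fun t ht => (hβ t ht).continuousWithinAt)
      (fun t ht => hasDerivWithinAt_Ici_of_Icc (hβ t ⟨ht.1, ht.2.le⟩) ht) (hmem β hβ0 hβ)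
      (fun t _ => by simp)
    rw [zero_mul] at this
    exact sub_eq_zero.1 (norm_le_zero_iff.1 this)
  · exact hcmp q q' R hq0 (fun t _ => (hq t).continuousAt.continuousWithinAt)
      (fun t _ => (hq t).hasDerivWithinAt) hqm hqR

end ODE

/-! ### The rescaled interpolating field of a single map -/

section Step

variable {m : ℕ}

/-- `D` contains `ball x r`, where the displacement `f - id` is of class `C^(2 n)` and, together
with its derivatives up to order `2 n`, is bounded by `C * η`. -/
structure IsNearIdentity (D : Set (Space m)) (f : Space m → Space m) (n : ℕ) (C η r : ℝ)
    (x : Space m) : Prop where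
  ball_subset : ball x r ⊆ D
  contDiffOn : ContDiffOn ℝ (2 * n : ℕ) (fun y => f y - y) (ball x r)
  norm_le : ∀ i ≤ 2 * n, ∀ z ∈ ball x r, ‖iteratedFDeriv ℝ i (fun y => f y - y) z‖ ≤ C * η

namespace IsNearIdentity

variable {D : Set (Space m)} {f : Space m → Space m} {n : ℕ} {C η r : ℝ} {x : Space m}

lemma norm_sub_le (h : IsNearIdentity D f n C η r x) {z : Space m} (hz : z ∈ ball x r) :
    ‖f z - z‖ ≤ C * η := by
  simpa using h.norm_le 0 (Nat.zero_le _) z hz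

lemma norm_sub_sub_le (h : IsNearIdentity D f n C η r x) (hn : 1 ≤ n) {z w : Space m}
    (hz : z ∈ ball x r) (hw : w ∈ ball x r) :
    ‖(f z - z) - (f w - w)‖ ≤ C * η * ‖z - w‖ := by
  refine (convex_ball x r).norm_image_sub_le_of_norm_fderiv_le (𝕜 := ℝ)
    (f := fun y => f y - y) (fun y hy => ?_) (fun y hy => ?_) hw hz
  · exact (h.contDiffOn.contDiffAt (isOpen_ball.mem_nhds hy)).differentiableAt
      (by exact_mod_cast (by omega : 2 * n ≠ 0))
  · rw [← norm_iteratedFDeriv_one]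
    exact h.norm_le 1 (by omega) y hy

end IsNearIdentity

/-- For `f = F_ε`, the field `ε • X_n(·, ε)`, whose time-one map is the time-`ε` map of the
interpolating field. No division by `ε` is involved. -/
def stepField (D : Set (Space m)) (f : Space m → Space m) (n : ℕ) (y : Space m) : Space m :=
  ∑ k ∈ nodes n, diffWeight n k • iter D f k y

lemma norm_sum_diffWeight_le {E : Type*} [NormedAddCommGroup E] [NormedSpace ℝ E] {n : ℕ}
    {c : ℤ → E} {R : ℝ} (hc : ∀ k ∈ Icc (-(n : ℤ)) n, ‖c k‖ ≤ R) :
    ‖∑ k ∈ nodes n, diffWeight n k • c k‖ ≤ (∑ k ∈ nodes n, |diffWeight n k|) * R := by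
  rw [Finset.sum_mul]
  refine norm_sum_le_of_le _ fun k hk => ?_
  rw [norm_smul, Real.norm_eq_abs]
  exact mul_le_mul_of_nonneg_left (hc k (Finset.mem_Icc.1 hk)) (abs_nonneg _)

lemma sum_diffWeight_smul_sub {E : Type*} [NormedAddCommGroup E] [NormedSpace ℝ E] (n : ℕ)
    (c : ℤ → E) (v : E) :
    ∑ k ∈ nodes n, diffWeight n k • (c k - v) = ∑ k ∈ nodes n, diffWeight n k • c k := by
  simp only [smul_sub, Finset.sum_sub_distrib, ← Finset.sum_smul, sum_diffWeight, zero_smul,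
    sub_zero]

/-- The properties of the rescaled interpolating field for a single map near the identity, with
constants that do not depend on the map: it is of order `η` and `O(η)`-Lipschitz, it agrees with the
displacement to second order, and the interpolating curve `q`, which goes from `x` to `f x`,
solves its differential equation up to order `η^(2 n + 1)`. -/
lemma exists_stepField_estimates (m : ℕ) {n : ℕ} (hn : 1 ≤ n) {C : ℝ} (hC : 0 ≤ C) :
    ∃ A K : ℝ, 0 ≤ A ∧ 0 ≤ K ∧ ∀ (D : Set (Space m)) (f : Space m → Space m) (η r : ℝ)
      (x : Space m), 0 ≤ η → η ≤ 1 → A * η < 1 → A * η < r → IsNearIdentity D f n C η r x →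
      closedBall x (r / 4) ⊆ iterDomain D f n ∧
      (∀ y ∈ closedBall x (r / 4), ‖stepField D f n y‖ ≤ K * η) ∧
      (∀ y ∈ closedBall x (r / 4), ∀ z ∈ closedBall x (r / 4),
        ‖stepField D f n y - stepField D f n z‖ ≤ K * η * ‖y - z‖) ∧
      ‖stepField D f n x - (f x - x)‖ ≤ K * η ^ 2 ∧
      ∃ q q' : ℝ → Space m, q 0 = x ∧ q 1 = f x ∧ (∀ s, HasDerivAt q (q' s) s) ∧
        (∀ s ∈ Icc (0 : ℝ) 1, q s ∈ closedBall x (r / 4)) ∧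
        ∀ s ∈ Icc (0 : ℝ) 1, ‖stepField D f n (q s) - q' s‖ ≤ K * η ^ (2 * n + 1) := by
  obtain ⟨A, K, hA1, hK0, hres⟩ := exists_bound_interp_defect (Space m) hn hC
  set W : ℝ := ∑ k ∈ nodes n, |diffWeight n k| with hW
  have hW0 : 0 ≤ W := by positivity
  have hn0 : (1 : ℝ) ≤ n := by exact_mod_cast hn
  refine ⟨4 * A + 16 * n * C, W * (n * C) + W * (n * (C * 4 ^ n)) + W * (n * (C * (n * (2 * C))))
    + W * (4 ^ n * K), by positivity, by positivity, ?_⟩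
  intro D f η r x hη hη1 hsmall1 hsmallr hf
  have hCη0 : 0 ≤ C * η := mul_nonneg hC hη
  have hnC : 0 ≤ n * (C * η) := by positivity
  have hCn : C * η ≤ n * (C * η) := le_mul_of_one_le_left hCη0 hn0
  have hAη : 0 ≤ A * η := by positivity
  have hhalf : C * η ≤ 1 / 2 := by nlinarith
  have hr4 : A * η + n * (2 * (C * η)) < r / 4 := by nlinarith
  have hr8 : n * (2 * (C * η)) < r / 8 := by nlinarith
  have hr0 : 0 < r := by linarith
  set u : Space m → Space m := fun y => f y - y with hu
  have hb : ∀ z ∈ ball x r, ‖f z - z‖ ≤ C * η := fun z hz => hf.norm_sub_le hz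
  have hL : ∀ z ∈ ball x r, ∀ w ∈ ball x r, ‖u z - u w‖ ≤ C * η * ‖z - w‖ := fun z hz w hw =>
    hf.norm_sub_sub_le hn hz hw
  have hL2 : ∀ z ∈ ball x r, ∀ w ∈ ball x r, ‖u z - u w‖ ≤ 1 / 2 * ‖z - w‖ := fun z hz w hw =>
    (hL z hz w hw).trans (mul_le_mul_of_nonneg_right hhalf (norm_nonneg _))
  -- orbits of points of `closedBall x (r / 4)`
  have horb : ∀ y ∈ closedBall x (r / 4),
      (∀ k ∈ Icc (-(n : ℤ)) n, iter D f k y ∈ closedBall y (n * (2 * (C * η)))) ∧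
      (∀ k ∈ Icc (-(n : ℤ)) n, iter D f k y ∈ ball x (r / 2)) ∧
      (∀ k ∈ Ico (-(n : ℤ)) n, f (iter D f k y) = iter D f (k + 1) y) := by
    intro y hy
    have hsub : closedBall y (n * (2 * (C * η))) ⊆ ball x (r / 2) := by
      intro z hz
      rw [mem_closedBall] at hy hz
      rw [mem_ball]
      linarith [dist_triangle z y x]
    have h1 := iter_orbit hCη0 hf.ball_subset hL2 hb
      (hsub.trans (ball_subset_ball (by linarith)))
    exact ⟨h1.1, fun k hk => hsub (h1.1 k hk), h1.2⟩
  have hball : ball x (r / 2) ⊆ ball x r := ball_subset_ball (by linarith)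
  have hstep : ∀ y ∈ closedBall x (r / 4), ∀ k ∈ Ico (-(n : ℤ)) n,
      iter D f (k + 1) y = iter D f k y + u (iter D f k y) := by
    intro y hy k hk
    rw [← (horb y hy).2.2 k hk]
    simp [hu]
  have hin : ∀ y ∈ closedBall x (r / 4), ∀ k ∈ Ico (-(n : ℤ)) n, iter D f k y ∈ ball x r :=
    fun y hy k hk => hball ((horb y hy).2.1 k ⟨hk.1, hk.2.le⟩)
  have hx4 : x ∈ closedBall x (r / 4) := mem_closedBall_self (by linarith)
  have hηp : 0 ≤ η ^ (2 * n + 1) := by positivity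
  refine ⟨fun y hy => ⟨fun k hk => hf.ball_subset (hball ((horb y hy).2.1 k hk)),
    (horb y hy).2.2⟩, ?_, ?_, ?_, ?_⟩
  · -- the weights sum to zero, so only the displacements along the orbit contribute
    intro y hy
    have h1 := norm_sub_zero_le_of_increments (n := n) (c := fun k => iter D f k y) (δ := C * η)
      (fun k hk => by
        rw [hstep y hy k hk, add_sub_cancel_left]; exact hb _ (hin y hy k hk))
    rw [stepField, ← sum_diffWeight_smul_sub n _ (iter D f 0 y)]
    refine (norm_sum_diffWeight_le h1).trans ?_
    rw [← hW]
    have e1 : W * (n * (C * η)) = W * (n * C) * η := by ring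
    rw [e1]
    refine mul_le_mul_of_nonneg_right ?_ hη
    have : 0 ≤ W * (n * (C * 4 ^ n)) + W * (n * (C * (n * (2 * C)))) + W * (4 ^ n * K) := by
      positivity
    linarith
  · -- two orbits keep their distance up to a factor, and the displacement is `C η`-Lipschitz
    intro y hy z hz
    have h0 := norm_orbit_sub_pseudoOrbit_le (n := n) (u := u) (δ := 0) le_rfl hL2
      (hin y hy) (hin z hz) (hstep y hy) (fun k hk => by rw [hstep z hz k hk]; simp)
    simp only [add_zero, iter_zero] at h0
    have h1 := norm_sub_zero_le_of_increments (n := n)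
      (c := fun k => iter D f k y - iter D f k z) (δ := C * η * (4 ^ n * ‖y - z‖))
      (fun k hk => by
        have e : iter D f (k + 1) y - iter D f (k + 1) z - (iter D f k y - iter D f k z)
            = u (iter D f k y) - u (iter D f k z) := by
          rw [hstep y hy k hk, hstep z hz k hk]; abel
        rw [e]
        refine (hL _ (hin y hy k hk) _ (hin z hz k hk)).trans ?_
        exact mul_le_mul_of_nonneg_left (h0 k ⟨hk.1, hk.2.le⟩) hCη0)
    have e2 : stepField D f n y - stepField D f n z = ∑ k ∈ nodes n,
        diffWeight n k • ((iter D f k y - iter D f k z) - (iter D f 0 y - iter D f 0 z)) := by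
      rw [sum_diffWeight_smul_sub]
      simp only [smul_sub, Finset.sum_sub_distrib, stepField]
    rw [e2]
    refine (norm_sum_diffWeight_le h1).trans ?_
    rw [← hW]
    have e1 : W * (n * (C * η * (4 ^ n * ‖y - z‖))) = W * (n * (C * 4 ^ n)) * (η * ‖y - z‖) := by
      ring
    rw [e1, mul_assoc _ η]
    refine mul_le_mul_of_nonneg_right ?_ (by positivity)
    have : 0 ≤ W * (n * C) + W * (n * (C * (n * (2 * C)))) + W * (4 ^ n * K) := by
      positivity
    linarith
  · -- the displacement varies by `O(η²)` along the orbit, and the formula is exact on `k ↦ k • u x`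
    have h1 := norm_sub_zero_le_of_increments (n := n)
      (c := fun k => iter D f k x - (k : ℝ) • u x) (δ := C * η * (n * (2 * (C * η))))
      (fun k hk => by
        have e : iter D f (k + 1) x - ((k + 1 : ℤ) : ℝ) • u x - (iter D f k x - (k : ℝ) • u x)
            = u (iter D f k x) - u x := by
          rw [hstep x hx4 k hk]; push_cast; rw [add_smul, one_smul]; abel
        rw [e]
        refine (hL _ (hin x hx4 k hk) _ (mem_ball_self hr0)).trans ?_
        refine mul_le_mul_of_nonneg_left ?_ hCη0
        have := (horb x hx4).1 k ⟨hk.1, hk.2.le⟩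
        rwa [mem_closedBall, dist_eq_norm] at this)
    have e2 : stepField D f n x - (f x - x) = ∑ k ∈ nodes n,
        diffWeight n k • ((iter D f k x - (k : ℝ) • u x) -
          (iter D f 0 x - ((0 : ℤ) : ℝ) • u x)) := by
      rw [sum_diffWeight_smul_sub]
      simp only [smul_sub, Finset.sum_sub_distrib, stepField, smul_smul, ← Finset.sum_smul,
        sum_diffWeight_mul hn, one_smul, hu]
    rw [e2]
    refine (norm_sum_diffWeight_le h1).trans ?_
    rw [← hW]
    have e1 : W * (n * (C * η * (n * (2 * (C * η))))) = W * (n * (C * (n * (2 * C)))) * η ^ 2 := by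
      ring
    rw [e1]
    refine mul_le_mul_of_nonneg_right ?_ (by positivity)
    have : 0 ≤ W * (n * C) + W * (n * (C * 4 ^ n)) + W * (4 ^ n * K) := by positivity
    linarith
  · set a : ℤ → Space m := fun k => iter D f k x with ha
    have hmn : -(n : ℤ) ∈ Icc (-(n : ℤ)) n := ⟨le_rfl, by omega⟩
    have hres' := hres r η x u hη hη1 (by linarith) hf.contDiffOn hf.norm_le a
      ((horb x hx4).2.1 _ hmn) (hstep x hx4)
    set q := nodeInterp n a with hq
    have hqmem : q ∈ polyCurve (Space m) (2 * n + 1) := nodeInterp_mem n a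
    have hqnear : ∀ s ∈ Icc (-(n : ℝ)) n, q s ∈ closedBall x (r / 4) := by
      intro s hs
      have h1 := (hres' s hs).1
      have h2 := (horb x hx4).1 _ hmn
      rw [mem_closedBall] at h2
      rw [← dist_eq_norm] at h1
      rw [mem_closedBall]
      linarith [dist_triangle (q s) (a (-n)) x]
    have hsub : Icc (0 : ℝ) 1 ⊆ Icc (-(n : ℝ)) n := Icc_subset_Icc (by linarith) hn0
    have h0 : q 0 = x := by
      have := nodeInterp_node a (k := 0) (n := n) (Finset.mem_Icc.2 ⟨by omega, by omega⟩)
      rw [Int.cast_zero] at this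
      exact this
    have h1 : q 1 = f x := by
      have := nodeInterp_node a (k := 1) (n := n) (Finset.mem_Icc.2 ⟨by omega, by omega⟩)
      rw [Int.cast_one] at this
      exact this
    refine ⟨q, deriv q, h0, h1, fun s => ?_, fun s hs => hqnear s (hsub hs), fun s hs => ?_⟩
    · exact ((polyCurve_contDiff hqmem (N := 1)).differentiable (by simp) s).hasDerivAt
    · have hsk : ∀ k ∈ Ico (-(n : ℤ)) n, s + k ∈ Icc (-(n : ℝ)) n := by
        intro k hk
        have hk1 : (-(n : ℝ)) ≤ k := by exact_mod_cast hk.1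
        have hk2 : (k : ℝ) + 1 ≤ n := by exact_mod_cast Int.add_one_le_of_lt hk.2
        exact ⟨by linarith [hs.1], by linarith [hs.2]⟩
      -- the true orbit of `q s` is shadowed by the pseudo-orbit `k ↦ q (s + k)`
      have hqs := hqnear s (hsub hs)
      have hsh := norm_orbit_sub_pseudoOrbit_le (n := n) (u := u) (δ := K * η ^ (2 * n + 1))
        (by positivity) hL2 (a := fun k => iter D f k (q s)) (b := fun k => q (s + k))
        (hin _ hqs)
        (fun k hk => closedBall_subset_ball (by linarith) (hqnear _ (hsk k hk)))
        (hstep _ hqs)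
        (fun k hk => by
          have := (hres' _ (hsk k hk)).2
          rw [add_assoc] at this
          push_cast
          exact this)
      simp only [iter_zero, Int.cast_zero, add_zero, sub_self, norm_zero, zero_add] at hsh
      rw [← sum_diffWeight_smul hqmem s, stepField, ← Finset.sum_sub_distrib]
      simp only [← smul_sub]
      refine (norm_sum_diffWeight_le hsh).trans ?_
      rw [← hW]
      have e1 : W * (4 ^ n * (K * η ^ (2 * n + 1))) = W * (4 ^ n * K) * η ^ (2 * n + 1) := by ring
      rw [e1]
      refine mul_le_mul_of_nonneg_right ?_ hηp
      have : 0 ≤ W * (n * C) + W * (n * (C * 4 ^ n)) + W * (n * (C * (n * (2 * C)))) := by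
        positivity
      linarith

end Step

/-! ### Uniformity near a compact set -/

section Uniform

variable {E F : Type*} [NormedAddCommGroup E] [NormedSpace ℝ E]
  [NormedAddCommGroup F] [NormedSpace ℝ F]

/-- Partial derivatives of order `j` in the second variable cost `j` orders of joint
differentiability. -/
lemma contDiffAt_iteratedFDeriv_param {f : ℝ → E → F} {q₀ : ℝ × E} (j : ℕ) :
    ∀ k : ℕ, ContDiffAt ℝ ((k + j : ℕ) : WithTop ℕ∞) (fun q : ℝ × E => f q.1 q.2) q₀ →
      ContDiffAt ℝ k (fun q : ℝ × E => iteratedFDeriv ℝ j (f q.1) q.2) q₀ := by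
  induction j with
  | zero =>
    intro k h
    have : (fun q : ℝ × E => iteratedFDeriv ℝ 0 (f q.1) q.2) =
        (continuousMultilinearCurryFin0 ℝ E F).symm ∘ fun q : ℝ × E => f q.1 q.2 := by
      ext q; simp [iteratedFDeriv_zero_eq_comp]
    rw [this]
    exact (LinearIsometryEquiv.contDiff _).contDiffAt.comp _ h
  | succ j ih =>
    intro k h
    have h1 := ih (k + 1) (by convert! h using 2; ring)
    have : (fun q : ℝ × E => iteratedFDeriv ℝ (j + 1) (f q.1) q.2) =
        (continuousMultilinearCurryLeftEquiv ℝ (fun _ : Fin (j + 1) => E) F).symm ∘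
          fun q : ℝ × E => fderiv ℝ (iteratedFDeriv ℝ j (f q.1)) q.2 := by
      ext q; simp [iteratedFDeriv_succ_eq_comp_left]
    rw [this]
    have hcurry : ContDiff ℝ k
        (continuousMultilinearCurryLeftEquiv ℝ (fun _ : Fin (j + 1) => E) F).symm :=
      LinearIsometryEquiv.contDiff (𝕜 := ℝ)
        (E := E →L[ℝ] ContinuousMultilinearMap ℝ (fun _ : Fin j => E) F)
        (F := ContinuousMultilinearMap ℝ (fun _ : Fin (j + 1) => E) F) _
    refine hcurry.contDiffAt.comp _ ?_
    refine ContDiffAt.fderiv (f := fun (q : ℝ × E) y => iteratedFDeriv ℝ j (f q.1) y)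
      (g := Prod.snd) (n := ((k + 1 : ℕ) : WithTop ℕ∞)) ?_ contDiffAt_snd (by norm_cast)
    exact ContDiffAt.comp (q₀, q₀.2)
      (f := fun p : (ℝ × E) × E => (p.1.1, p.2)) h1
      ((contDiff_fst.fst.prodMk contDiff_snd).contDiffAt)

/-- A `C¹` function that vanishes at parameter zero is locally of the order of the parameter. -/
lemma eventually_norm_le_mul_abs {G : ℝ × E → F} {y : E} (hG : ContDiffAt ℝ 1 G (0, y))
    (h0 : ∀ᶠ z in 𝓝 y, G (0, z) = 0) :
    ∃ C : ℝ, ∀ᶠ q in 𝓝 ((0 : ℝ), y), ‖G q‖ ≤ C * |q.1| := by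
  obtain ⟨K, t, ht, hK⟩ := hG.exists_lipschitzOnWith
  have hproj : Tendsto (fun q : ℝ × E => ((0 : ℝ), q.2)) (𝓝 (0, y)) (𝓝 (0, y)) := by
    have : Continuous fun q : ℝ × E => ((0 : ℝ), q.2) := by fun_prop
    exact this.tendsto _
  have hsnd : Tendsto (fun q : ℝ × E => q.2) (𝓝 ((0 : ℝ), y)) (𝓝 y) :=
    continuous_snd.tendsto _
  refine ⟨K, ?_⟩
  filter_upwards [ht, hproj ht, hsnd h0] with q hq hq0 hG0
  have := hK.dist_le_mul q hq (0, q.2) hq0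
  have hG0' : G (0, q.2) = 0 := hG0
  rw [hG0', dist_zero_right] at this
  simpa [Prod.dist_eq] using this

lemma exists_uniform_bound_of_isCompact {X : Type*} [TopologicalSpace X]
    {N : ℝ → X → ℝ} {S : Set X} (hS : IsCompact S)
    (h : ∀ y ∈ S, ∃ C : ℝ, ∀ᶠ q in 𝓝 ((0 : ℝ), y), N q.1 q.2 ≤ C * |q.1|) :
    ∃ C : ℝ, ∀ᶠ ε in 𝓝 (0 : ℝ), ∀ y ∈ S, N ε y ≤ C * |ε| := by
  refine hS.induction_on (p := fun S => ∃ C : ℝ, ∀ᶠ ε in 𝓝 (0 : ℝ), ∀ y ∈ S, N ε y ≤ C * |ε|)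
    ⟨0, by simp⟩ ?_ ?_ ?_
  · rintro s t hst ⟨C, hC⟩
    exact ⟨C, hC.mono fun ε h y hy => h y (hst hy)⟩
  · rintro s t ⟨C₁, h₁⟩ ⟨C₂, h₂⟩
    refine ⟨max C₁ C₂, ?_⟩
    filter_upwards [h₁, h₂] with ε h₁ h₂ y hy
    rcases hy with hy | hy
    · exact (h₁ y hy).trans (mul_le_mul_of_nonneg_right (le_max_left _ _) (abs_nonneg _))
    · exact (h₂ y hy).trans (mul_le_mul_of_nonneg_right (le_max_right _ _) (abs_nonneg _))
  · intro y hy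
    obtain ⟨C, hC⟩ := h y hy
    rw [nhds_prod_eq, eventually_prod_iff] at hC
    obtain ⟨pa, ha, pb, hb, hab⟩ := hC
    exact ⟨{z | pb z}, mem_nhdsWithin_of_mem_nhds hb, C, ha.mono fun ε hε z hz => hab hε hz⟩

/-- A near-identity family of class `C^(2 n + 1)` is, uniformly near a compact set, close to the
identity of order `ε` in class `C^(2 n)`. -/
lemma eventually_isNearIdentity {m n : ℕ} {D : Set (Space m)} (hD : IsOpen D)
    {ε₀ : ℝ} (hε₀ : 0 < ε₀) {F : ℝ → Space m → Space m}
    (hF : ContDiffOn ℝ ((2 * n + 1 : ℕ) : WithTop ℕ∞)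
      (fun q : ℝ × Space m => F q.1 q.2) (Set.Ioo (-ε₀) ε₀ ×ˢ D))
    (hF0 : ∀ x ∈ D, F 0 x = x) {D₀ : Set (Space m)} (hD₀ : IsCompact D₀) (hD₀D : D₀ ⊆ D) :
    ∃ C r : ℝ, 0 ≤ C ∧ 0 < r ∧
      ∀ᶠ ε in 𝓝 (0 : ℝ), ∀ x ∈ D₀, IsNearIdentity D (F ε) n C |ε| r x := by
  obtain ⟨r, hr, hrD⟩ := hD₀.exists_cthickening_subset_open hD hD₀D
  have hK : IsCompact (cthickening r D₀) := hD₀.cthickening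
  have hopen : IsOpen (Set.Ioo (-ε₀) ε₀ ×ˢ D) := isOpen_Ioo.prod hD
  set u : ℝ → Space m → Space m := fun ε y => F ε y - y with hu
  have hucd : ContDiffOn ℝ ((2 * n + 1 : ℕ) : WithTop ℕ∞)
      (fun q : ℝ × Space m => u q.1 q.2) (Set.Ioo (-ε₀) ε₀ ×ˢ D) :=
    hF.sub contDiff_snd.contDiffOn
  have hbound : ∀ i ≤ 2 * n, ∃ C : ℝ, ∀ᶠ ε in 𝓝 (0 : ℝ), ∀ y ∈ cthickening r D₀,
      ‖iteratedFDeriv ℝ i (u ε) y‖ ≤ C * |ε| := by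
    intro i hi
    refine exists_uniform_bound_of_isCompact
      (N := fun ε y => ‖iteratedFDeriv ℝ i (u ε) y‖) hK fun y hy => ?_
    have hyD := hrD hy
    have hat : ContDiffAt ℝ ((1 + i : ℕ) : WithTop ℕ∞) (fun q : ℝ × Space m => u q.1 q.2) (0, y) :=
      (hucd.contDiffAt (hopen.mem_nhds ⟨⟨by linarith, hε₀⟩, hyD⟩)).of_le
        (by exact_mod_cast (by omega : 1 + i ≤ 2 * n + 1))
    refine eventually_norm_le_mul_abs
      (G := fun q : ℝ × Space m => iteratedFDeriv ℝ i (u q.1) q.2)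
      (by exact_mod_cast contDiffAt_iteratedFDeriv_param i 1 hat) ?_
    filter_upwards [hD.mem_nhds hyD] with z hz
    -- the displacement `u 0` vanishes on the open set `D`, hence so do its derivatives there
    have h0 : u 0 =ᶠ[𝓝 z] fun _ => (0 : Space m) := by
      filter_upwards [hD.mem_nhds hz] with w hw
      simp [hu, hF0 w hw]
    have h1 := Filter.EventuallyEq.iteratedFDeriv (𝕜 := ℝ) h0 i
    have h2 := h1.eq_of_nhds
    have h3 : iteratedFDeriv ℝ i (fun _ : Space m => (0 : Space m)) z = 0 := by
      simp
    exact h2.trans h3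
  choose! C hC using hbound
  refine ⟨∑ i ∈ Finset.range (2 * n + 1), |C i|, r, by positivity, hr, ?_⟩
  have hall : ∀ᶠ ε in 𝓝 (0 : ℝ), ∀ i ∈ Finset.range (2 * n + 1), ∀ y ∈ cthickening r D₀,
      ‖iteratedFDeriv ℝ i (u ε) y‖ ≤ C i * |ε| :=
    (Finset.range (2 * n + 1)).eventually_all.2 fun i hi =>
      hC i (Nat.lt_succ_iff.1 (Finset.mem_range.1 hi))
  filter_upwards [hall, Ioo_mem_nhds (neg_lt_zero.2 hε₀) hε₀] with ε hε hε' x hx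
  have hsub : ball x r ⊆ cthickening r D₀ :=
    (ball_subset_thickening hx r).trans (thickening_subset_cthickening r D₀)
  refine ⟨hsub.trans hrD, ?_, fun i hi z hz => ?_⟩
  · refine (ContDiffOn.comp (hucd.of_le (m := (2 * n : ℕ))
      (by exact_mod_cast (by omega : 2 * n ≤ 2 * n + 1)))
      (f := fun y : Space m => (ε, y)) (contDiff_const.prodMk contDiff_id).contDiffOn ?_ :)
    exact fun y hy => ⟨hε', hrD (hsub hy)⟩
  · have hi' : i ∈ Finset.range (2 * n + 1) := Finset.mem_range.2 (by omega)
    refine (hε i hi' z (hsub hz)).trans (mul_le_mul_of_nonneg_right ?_ (abs_nonneg _))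
    exact (le_abs_self _).trans
      (Finset.single_le_sum (f := fun i => |C i|) (fun _ _ => abs_nonneg _) hi')

end Uniform

/-! ### The interpolating field and its flow -/

section Field

variable {m n : ℕ} {D : Set (Space m)} {F : ℝ → Space m → Space m}

/-- After rescaling time by `ε`, the interpolating curve has the integers as nodes. -/
lemma interpCurve_eq {ε : ℝ} (hε : ε ≠ 0) (x : Space m) (t : ℝ) :
    interpCurve D F n x ε t = nodeInterp n (fun k => iter D (F ε) k x) (t / ε) := by
  refine Finset.sum_congr rfl fun k _ => ?_
  congr 1
  simp only [nodeBasis, Lagrange.basis, Lagrange.basisDivisor, Polynomial.eval_prod,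
    Polynomial.eval_mul, Polynomial.eval_C, Polynomial.eval_sub, Polynomial.eval_X]
  refine Finset.prod_congr rfl fun j _ => ?_
  rw [← mul_sub, mul_inv]
  field_simp

lemma deriv_interpCurve {ε : ℝ} (hε : ε ≠ 0) (x : Space m) :
    deriv (interpCurve D F n x ε) 0 = ε⁻¹ • stepField D (F ε) n x := by
  have h1 : interpCurve D F n x ε =
      nodeInterp n (fun k => iter D (F ε) k x) ∘ fun t => t / ε := by
    ext1 t; exact interpCurve_eq hε x t
  have h2 := hasDerivAt_nodeInterp n (fun k => iter D (F ε) k x) ((0 : ℝ) / ε)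
  have h3 := HasDerivAt.scomp (0 : ℝ) h2 ((hasDerivAt_id (0 : ℝ)).div_const ε)
  rw [h1]
  refine h3.deriv.trans ?_
  rw [one_div, zero_div]
  rfl

lemma interpField_of_ne {ε : ℝ} (hε : ε ≠ 0) :
    interpField D F n ε = fun x => ε⁻¹ • stepField D (F ε) n x := by
  ext1 x
  rw [interpField, if_neg hε, deriv_interpCurve hε]

/-- Rescaling time by `ε`, of either sign, turns the time-`ε` map of `ε⁻¹ • g` into the time-one
map of `g`. -/
lemma flowsTo_smul_iff {U : Set (Space m)} {g : Space m → Space m} {ε : ℝ} (hε : ε ≠ 0)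
    {x y : Space m} :
    FlowsTo U (fun z => ε⁻¹ • g z) ε x y ↔ ∃ γ : ℝ → Space m, γ 0 = x ∧ γ 1 = y ∧
      (∀ t ∈ Icc (0 : ℝ) 1, γ t ∈ U) ∧
      ∀ t ∈ Icc (0 : ℝ) 1, HasDerivWithinAt γ (g (γ t)) (Icc 0 1) t := by
  have hto : ∀ t ∈ Icc (0 : ℝ) 1, t * ε ∈ uIcc 0 ε := by
    intro t ht
    rw [mem_uIcc]
    rcases le_total 0 ε with h | h
    · exact Or.inl ⟨mul_nonneg ht.1 h, mul_le_of_le_one_left h ht.2⟩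
    · exact Or.inr ⟨by nlinarith [ht.2], mul_nonpos_of_nonneg_of_nonpos ht.1 h⟩
  have hfrom : ∀ t ∈ uIcc 0 ε, t / ε ∈ Icc (0 : ℝ) 1 := by
    intro t ht
    rw [mem_uIcc] at ht
    rcases lt_or_gt_of_ne hε with h | h
    · have ht' : ε ≤ t ∧ t ≤ 0 := by
        rcases ht with ht | ht
        · exact ⟨by linarith, by linarith⟩
        · exact ht
      exact ⟨div_nonneg_of_nonpos ht'.2 h.le, by rw [div_le_one_of_neg h]; exact ht'.1⟩
    · have ht' : 0 ≤ t ∧ t ≤ ε := by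
        rcases ht with ht | ht
        · exact ht
        · exact ⟨by linarith, by linarith⟩
      exact ⟨div_nonneg ht'.1 h.le, by rw [div_le_one h]; exact ht'.2⟩
  constructor
  · rintro ⟨γ, h0, h1, hU, hγ⟩
    refine ⟨fun t => γ (t * ε), by simpa using h0, by simpa using h1,
      fun t ht => hU _ (hto t ht), fun t ht => ?_⟩
    have := HasDerivWithinAt.scomp t (hγ (t * ε) (hto t ht))
      (hasDerivAt_mul_const ε).hasDerivWithinAt hto
    simpa [smul_smul, mul_inv_cancel₀ hε] using! this
  · rintro ⟨γ, h0, h1, hU, hγ⟩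
    refine ⟨fun t => γ (t / ε), by simpa using h0, by simpa [div_self hε] using h1,
      fun t ht => hU _ (hfrom t ht), fun t ht => ?_⟩
    have := HasDerivWithinAt.scomp t (hγ (t / ε) (hfrom t ht))
      ((hasDerivAt_id t).div_const ε).hasDerivWithinAt hfrom
    simpa using! this

lemma flowsTo_zero_iff {U : Set (Space m)} {v : Space m → Space m} {x y : Space m} (hx : x ∈ U) :
    FlowsTo U v 0 x y ↔ y = x := by
  constructor
  · rintro ⟨γ, h0, h1, -⟩
    rw [← h0, ← h1]
  · rintro rfl
    refine ⟨fun _ => y, rfl, rfl, fun _ _ => hx, fun t ht => ?_⟩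
    rw [uIcc_self] at ht ⊢
    obtain rfl : t = 0 := ht
    rw [hasDerivWithinAt_iff_hasFDerivWithinAt]
    exact HasFDerivWithinAt.of_subsingleton subsingleton_singleton

lemma timeMap_eq {U : Set (Space m)} {v : Space m → Space m} {T : ℝ} {x y : Space m}
    (hy : FlowsTo U v T x y) (huniq : ∀ z, FlowsTo U v T x z → z = y) : timeMap U v T x = y := by
  have hex : ∃ y, FlowsTo U v T x y := ⟨y, hy⟩
  rw [timeMap, dif_pos hex]
  exact huniq _ hex.choose_spec

/-- The limit of the interpolating field is the velocity `∂_ε F_ε(x)` at `ε = 0`. -/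
lemma tendsto_deriv_interpCurve {x v : Space m} {K : ℝ}
    (hv : HasDerivAt (fun ε => F ε x) v 0) (h0 : F 0 x = x)
    (hK : ∀ᶠ ε in 𝓝 (0 : ℝ), ‖stepField D (F ε) n x - (F ε x - x)‖ ≤ K * |ε| ^ 2) :
    Tendsto (fun ε => deriv (interpCurve D F n x ε) 0) (𝓝[≠] (0 : ℝ)) (𝓝 v) := by
  have hslope := hasDerivAt_iff_tendsto_slope_zero.1 hv
  simp only [zero_add, h0] at hslope
  have hsmall : Tendsto (fun ε : ℝ => ε⁻¹ • (stepField D (F ε) n x - (F ε x - x)))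
      (𝓝[≠] (0 : ℝ)) (𝓝 0) := by
    refine squeeze_zero_norm' (a := fun ε => K * |ε|) ?_ ?_
    · filter_upwards [self_mem_nhdsWithin, nhdsWithin_le_nhds hK] with ε hε hKε
      have hε : ε ≠ 0 := hε
      rw [norm_smul, norm_inv, Real.norm_eq_abs, inv_mul_le_iff₀ (abs_pos.2 hε)]
      linarith [hKε, (by ring : K * |ε| ^ 2 = |ε| * (K * |ε|))]
    · have : Continuous fun ε : ℝ => K * |ε| := by fun_prop
      simpa using (this.tendsto 0).mono_left nhdsWithin_le_nhds
  have hsum := hslope.add hsmall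
  rw [add_zero] at hsum
  refine hsum.congr' ?_
  filter_upwards [self_mem_nhdsWithin] with ε hε
  rw [deriv_interpCurve hε, ← smul_add, add_sub_cancel]

end Field

end InterpVF

end

theorem mainTheorem2 {m n : ℕ} (hn : 1 ≤ n) {D : Set (InterpVF.Space m)} (hD : IsOpen D)
    {ε₀ : ℝ} (hε₀ : 0 < ε₀) (F : ℝ → InterpVF.Space m → InterpVF.Space m)
    (hF : ContDiffOn ℝ ((2 * n + 1 : ℕ) : WithTop ℕ∞)
      (fun q : ℝ × InterpVF.Space m => F q.1 q.2) (Set.Ioo (-ε₀) ε₀ ×ˢ D))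
    (hF0 : ∀ x ∈ D, F 0 x = x)
    {D₀ : Set (InterpVF.Space m)} (hD₀ : IsCompact D₀) (hD₀D : D₀ ⊆ D) :
    ∃ ε₁ : ℝ, 0 < ε₁ ∧ ε₁ ≤ ε₀ ∧
      -- the iterates that define the field exist, and so does its extension to parameter zero
      (∀ ε : ℝ, |ε| < ε₁ → D₀ ⊆ InterpVF.iterDomain D (F ε) n) ∧
      (∀ x ∈ D₀, Tendsto (fun ε => InterpVF.interpField D F n ε x) (𝓝[≠] (0 : ℝ))
        (𝓝 (InterpVF.interpField D F n 0 x))) ∧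
      -- uniform boundedness
      (∃ M : ℝ, ∀ ε : ℝ, |ε| < ε₁ → ∀ x ∈ D₀, ‖InterpVF.interpField D F n ε x‖ ≤ M) ∧
      -- the time-ε map is well defined, and it approximates the family
      (∀ ε : ℝ, |ε| < ε₁ → ∀ x ∈ D₀,
        ∃! y, InterpVF.FlowsTo (InterpVF.iterDomain D (F ε) n)
          (InterpVF.interpField D F n ε) ε x y) ∧
      ∃ C : ℝ, ∀ ε : ℝ, |ε| < ε₁ → ∀ x ∈ D₀,
        ‖F ε x - InterpVF.timeMap (InterpVF.iterDomain D (F ε) n)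
          (InterpVF.interpField D F n ε) ε x‖ ≤ C * |ε| ^ (2 * n + 1) := by
  open InterpVF Metric in
  obtain ⟨C, r, hC, hr, hev⟩ := eventually_isNearIdentity (n := n) hD hε₀ hF hF0 hD₀ hD₀D
  obtain ⟨A, K, hA, hK, hest⟩ := exists_stepField_estimates m hn hC
  have hsm : ∀ a b : ℝ, 0 < b → ∀ᶠ ε in 𝓝 (0 : ℝ), a * |ε| < b := by
    intro a b hb
    have : Continuous fun ε : ℝ => a * |ε| := by fun_prop
    exact this.tendsto 0 |>.eventually_lt_const (by simpa using hb)
  have hall : ∀ᶠ ε in 𝓝 (0 : ℝ), (∀ x ∈ D₀, IsNearIdentity D (F ε) n C |ε| r x) ∧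
      1 * |ε| < 1 ∧ A * |ε| < 1 ∧ A * |ε| < r ∧ K * |ε| < r / 4 ∧ K * |ε| < 1 := by
    filter_upwards [hev, hsm 1 1 one_pos, hsm A 1 one_pos, hsm A r hr,
      hsm K (r / 4) (by linarith), hsm K 1 one_pos] with ε h1 h2 h3 h4 h5 h6
    exact ⟨h1, h2, h3, h4, h5, h6⟩
  obtain ⟨δ, hδ, hδall⟩ := Metric.eventually_nhds_iff.1 hall
  have hsmall : ∀ ε : ℝ, |ε| < min δ ε₀ → (∀ x ∈ D₀, IsNearIdentity D (F ε) n C |ε| r x) ∧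
      1 * |ε| < 1 ∧ A * |ε| < 1 ∧ A * |ε| < r ∧ K * |ε| < r / 4 ∧ K * |ε| < 1 :=
    fun ε hε => hδall (by rw [Real.dist_eq, sub_zero]; exact hε.trans_le (min_le_left _ _))
  have hε₁ : 0 < min δ ε₀ := lt_min hδ hε₀
  have hmain := fun (ε : ℝ) (hε : |ε| < min δ ε₀) (x : Space m) (hx : x ∈ D₀) =>
    hest D (F ε) |ε| r x (abs_nonneg ε) (by linarith [(hsmall ε hε).2.1]) (hsmall ε hε).2.2.1
      (hsmall ε hε).2.2.2.1 ((hsmall ε hε).1 x hx)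
  have hr4 : 0 ≤ r / 4 := by linarith
  have hdom : ∀ ε : ℝ, |ε| < min δ ε₀ → D₀ ⊆ iterDomain D (F ε) n := fun ε hε x hx =>
    (hmain ε hε x hx).1 (mem_closedBall_self hr4)
  have hnear : ∀ᶠ ε in 𝓝 (0 : ℝ), |ε| < min δ ε₀ := by
    simpa using hsm 1 (min δ ε₀) hε₁
  have hlim : ∀ x ∈ D₀, Tendsto (fun ε => interpField D F n ε x) (𝓝[≠] (0 : ℝ))
      (𝓝 (interpField D F n 0 x)) := by
    intro x hx
    have hdiff : DifferentiableAt ℝ (fun ε => F ε x) 0 := by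
      have h1 : DifferentiableAt ℝ (fun q : ℝ × Space m => F q.1 q.2) (0, x) :=
        (hF.contDiffAt ((isOpen_Ioo.prod hD).mem_nhds
          ⟨⟨by linarith, hε₀⟩, hD₀D hx⟩)).differentiableAt
            (by exact_mod_cast (by omega : 2 * n + 1 ≠ 0))
      exact DifferentiableAt.comp (0 : ℝ) (f := fun ε : ℝ => (ε, x)) h1
        (differentiableAt_id.prodMk (differentiableAt_const x))
    -- `interpField` at `0` is a `limUnder`, which has the right value because the limit exists
    have h1 := tendsto_deriv_interpCurve (D := D) (n := n) (K := K) hdiff.hasDerivAt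
      (hF0 x (hD₀D hx)) (hnear.mono fun ε hε => (hmain ε hε x hx).2.2.2.1)
    have h2 : interpField D F n 0 x = deriv (fun ε => F ε x) 0 := by
      rw [interpField, if_pos rfl]
      exact h1.limUnder_eq
    rw [h2]
    refine h1.congr' ?_
    filter_upwards [self_mem_nhdsWithin] with ε hε
    have hε0 : ε ≠ 0 := hε
    rw [interpField, if_neg hε0]
  have hbd : ∀ ε : ℝ, |ε| < min δ ε₀ → ε ≠ 0 → ∀ x ∈ D₀, ‖interpField D F n ε x‖ ≤ K := by
    intro ε hε hε0 x hx
    rw [interpField_of_ne hε0, norm_smul, norm_inv, Real.norm_eq_abs,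
      inv_mul_le_iff₀ (abs_pos.2 hε0), mul_comm]
    exact (hmain ε hε x hx).2.1 x (mem_closedBall_self hr4)
  have hflow : ∀ ε : ℝ, |ε| < min δ ε₀ → ∀ x ∈ D₀, ∃ y,
      FlowsTo (iterDomain D (F ε) n) (interpField D F n ε) ε x y ∧
      (∀ z, FlowsTo (iterDomain D (F ε) n) (interpField D F n ε) ε x z → z = y) ∧
      ‖F ε x - y‖ ≤ K * (Real.exp 1 - 1) * |ε| ^ (2 * n + 1) := by
    intro ε hε x hx
    rcases eq_or_ne ε 0 with rfl | hε0
    · refine ⟨x, (flowsTo_zero_iff (hdom 0 hε hx)).2 rfl,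
        fun z hz => (flowsTo_zero_iff (hdom 0 hε hx)).1 hz, ?_⟩
      simp [hF0 x (hD₀D hx)]
    · obtain ⟨h1, h2, h3, -, q, q', hq0, hq1, hq, hqm, hqR⟩ := hmain ε hε x hx
      obtain ⟨-, -, -, -, h4, h5⟩ := hsmall ε hε
      obtain ⟨γ, hγ0, hγ, hγm, huniq, happ⟩ := slow_field_dynamics hr4 h4 h2
        (fun y hy z hz => (h3 y hy z hz).trans
          (mul_le_of_le_one_left (norm_nonneg _) h5.le))
      rw [interpField_of_ne hε0]
      refine ⟨γ 1, (flowsTo_smul_iff hε0).2 ⟨γ, hγ0, rfl, fun t ht => h1 (hγm t ht), hγ⟩,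
        fun z hz => ?_, ?_⟩
      · obtain ⟨β, hβ0, hβ1, -, hβ⟩ := (flowsTo_smul_iff hε0).1 hz
        rw [← hβ1]
        exact huniq β hβ0 hβ
      · rw [← hq1]
        refine (happ q q' _ hq0 hq hqm hqR).trans_eq ?_
        ring
  refine ⟨min δ ε₀, hε₁, min_le_right _ _, hdom, hlim, ⟨K, fun ε hε x hx => ?_⟩,
    fun ε hε x hx => ?_, K * (Real.exp 1 - 1), fun ε hε x hx => ?_⟩
  · rcases eq_or_ne ε 0 with rfl | hε0
    · refine le_of_tendsto (hlim x hx).norm ?_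
      filter_upwards [self_mem_nhdsWithin, nhdsWithin_le_nhds hnear] with ε hε0 hε
      exact hbd ε hε hε0 x hx
    · exact hbd ε hε hε0 x hx
  · obtain ⟨y, hy, huniq, -⟩ := hflow ε hε x hx
    exact ⟨y, hy, huniq⟩
  · obtain ⟨y, hy, huniq, hle⟩ := hflow ε hε x hx
    rw [timeMap_eq hy huniq]
    exact hle
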